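/- Let $n_1,n_2,n_3\ge 1$ and $c>0$. Tile the three-torus by an $n_1\times n_2\times n_3$ grid of parallelepiped blocks with opposite sides identified, each block having edge vectors $c\,v_x,c\,v_y,c\,v_z$, where $(v_x,v_y,v_z)$ is the standard basis of $\mathbb R^3$ (cubic triangulation) or $v_x=(1,-\tfrac13,0)$, $v_y=(0,1,0)$, $v_z=(-\tfrac13,-\tfrac29,1)$ (skew triangulation). Divide each block into the six tetrahedra that share its body-diagonal $v_x+v_y+v_z$, so that the face-diagonals are the translates of $v_y+v_z$, $v_z+v_x$, $v_x+v_y$. For a set of edge-lengths $|\ell|$ on this triangulation let $\epsilon_\ell$ be $2\pi$ minus the sum of the dihedral angles at $\ell$, $V_v$ the volume of the barycentric dual cell of the vertex $v$, and $V_\ell$ the volume of the union of the dual cells of the two ends of $\ell$, capped by the surfaces through these ends orthogonal to $\ell$. Put $$R_v=\frac1{V_v}\sum_{i}|\ell_i|\,\epsilon_i,\qquad K^\perp_\ell=\frac1{V_\ell}\Big(|\ell|\,\epsilon_\ell+\sum_{i}\tfrac12|\ell_i|\cos^2(\theta_i)\,\epsilon_i\Big),\qquad Rc_\ell=\tfrac14(R_{v_1}+R_{v_2})-K^\perp_\ell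 ,$$ where the first sum is over the edges $\ell_i$ at $v$, the second over the edges $\ell_i$ that lie in a common triangle with $\ell$, $\theta_i$ is the angle between $\ell_i$ and $\ell$, and $v_1,v_2$ are the ends of $\ell$. The piecewise flat Ricci flow is $\frac{d|\ell|}{dt}=-|\ell|\,Rc_\ell$. Perturb the lengths of the face-diagonals of the flat triangulation by $\delta=(\delta_j)$, keep the lengths of the edges in the directions $v_x,v_y,v_z$, and re-define the length of each body-diagonal, as a function of $\delta$ that is continuous at $\delta=0$ and has the flat value there, so that the deficit angle at each body-diagonal vanishes (flat blocks). Such a re-definition exists for all small $\delta$. For every such re-definition, and also for every one for which these deficit angles vanish only to first order in $\delta$ (linearized constraint), $\delta=0$ is a stationary solution of the equations that the flow gives for the face-diagonals, these equations are differentiable at $\delta=0$, and the coefficient matrix $A$ of their linearization $\frac{d\delta}{dt}=A\,\delta$ has the following properties: every row of $A$ has sum zero; the all-ones vector is an eigenvector of $A$ with eigenvalue $0$; and $A\,w=0$ for every vector $w$ that takes a single value on all face-diagonals of each of the three directions. In particular, neither the all-ones vector nor a vector that is constant on each of the three types of face-diagonal gives a positive eigenvalue, so summing rows of $A$ no longer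 implies linear instability. -/

import Mathlib

open Filter Topology MeasureTheory Asymptotics
open scoped Matrix

noncomputable section

namespace FlatBlocks

/-! ### Combinatorics of a three-torus grid of cubic or skew blocks -/

/-- Vertices of an `n 0 × n 1 × n 2` grid of blocks with opposite sides identified.  The vertex `v`
is also used as the name of the block whose lowest corner it is. -/
abbrev Vertex (n : Fin 3 → ℕ) : Type := (i : Fin 3) → ZMod (n i)

/-- The seven edge directions, as non-empty sets of coordinate directions: `{0}, {1}, {2}` are the
`x, y, z`-edges, `{1, 2}, {0, 2}, {0, 1}` the `yz, zx, xy`-face-diagonals and `{0, 1, 2}` the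
body-diagonal. -/
abbrev Dir : Type := {S : Finset (Fin 3) // S.Nonempty}

/-- The edge `(v, S)` runs from the vertex `v` to the vertex obtained from `v` by one step in each
of the coordinate directions in `S`. -/
abbrev Edge (n : Fin 3 → ℕ) : Type := Vertex n × Dir

/-- The displacement on the grid given by one step in each of the directions in `S`. -/
def offset (n : Fin 3 → ℕ) (S : Finset (Fin 3)) : Vertex n := fun i => if i ∈ S then 1 else 0

/-- The same displacement as a vector in block coordinates. -/
def coord (S : Finset (Fin 3)) : Fin 3 → ℝ := fun i => if i ∈ S then 1 else 0

/-- The tetrahedron `(v, σ)` of the block `v`: its vertices, numbered `0, 1, 2, 3`, are met in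
walking from `v` to the opposite corner of the block by one step in each of the directions
`σ 0, σ 1, σ 2`, in that order.  The six tetrahedra of a block share its body-diagonal. -/
abbrev Tet (n : Fin 3 → ℕ) : Type := Vertex n × Equiv.Perm (Fin 3)

/-- The directions in which the walk `σ` has gone when it reaches vertex number `a`. -/
def reach (σ : Equiv.Perm (Fin 3)) (a : Fin 4) : Finset (Fin 3) :=
  Finset.univ.filter fun i => (σ.symm i).castSucc < a

/-- The tetrahedron of shape `σ` whose vertex number `a` is `v`. -/
def tetAt {n : Fin 3 → ℕ} (v : Vertex n) (σ : Equiv.Perm (Fin 3)) (a : Fin 4) : Tet n :=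
  (v - offset n (reach σ a), σ)

/-- The length of the edge of the tetrahedron `T` between its vertices number `a` and `b`. -/
def side {n : Fin 3 → ℕ} (L : Edge n → ℝ) (T : Tet n) (a b : Fin 4) : ℝ :=
  if h : (reach T.2 b \ reach T.2 a).Nonempty then
    L (T.1 + offset n (reach T.2 a), ⟨reach T.2 b \ reach T.2 a, h⟩)
  else if h : (reach T.2 a \ reach T.2 b).Nonempty then
    L (T.1 + offset n (reach T.2 b), ⟨reach T.2 a \ reach T.2 b, h⟩)
  else 0

/-! ### Geometry determined by the edge-lengths -/

/-- The Euclidean metric of the tetrahedron `T`, written in block coordinates.  The `i`-th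
coordinate vector is the edge of `T` from its vertex number `σ⁻¹ i` to the next one, and inner
products of edge vectors are determined by the lengths through
`2 ⟨B - A, D - C⟩ = |AD|² + |BC|² - |AC|² - |BD|²`. -/
def metric {n : Fin 3 → ℕ} (L : Edge n → ℝ) (T : Tet n) : Matrix (Fin 3) (Fin 3) ℝ :=
  Matrix.of fun i j =>
    (side L T (T.2.symm i).castSucc (T.2.symm j).succ ^ 2
      + side L T (T.2.symm i).succ (T.2.symm j).castSucc ^ 2
      - side L T (T.2.symm i).castSucc (T.2.symm j).castSucc ^ 2
      - side L T (T.2.symm i).succ (T.2.symm j).succ ^ 2) / 2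

/-- The inner product with matrix `g`. -/
def ip (g : Matrix (Fin 3) (Fin 3) ℝ) (u w : Fin 3 → ℝ) : ℝ := u ⬝ᵥ (g *ᵥ w)

/-- The angle, for the inner product `g`, between the components of `p` and `q` orthogonal to `u`:
the dihedral angle along `u` between the half-planes containing `p` and `q`. -/
def dihedral (g : Matrix (Fin 3) (Fin 3) ℝ) (u p q : Fin 3 → ℝ) : ℝ :=
  Real.arccos ((ip g u u * ip g p q - ip g u p * ip g u q) /
    (Real.sqrt (ip g u u * ip g p p - ip g u p ^ 2) *
      Real.sqrt (ip g u u * ip g q q - ip g u q ^ 2)))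

/-- The vector from vertex number `a` to vertex number `b` of a tetrahedron of shape `σ`, in block
coordinates. -/
def vec (σ : Equiv.Perm (Fin 3)) (a b : Fin 4) : Fin 3 → ℝ :=
  coord (reach σ b) - coord (reach σ a)

/-- The tetrahedra around an edge of direction `S`: pairs of a shape `σ` and a listing
`τ 0, τ 1, τ 2, τ 3` of the four vertex numbers such that the edge from number `τ 0` to number
`τ 1` has direction `S`; numbers `τ 2` and `τ 3` are the vertices not on the edge. -/
def around (S : Dir) : Finset (Equiv.Perm (Fin 3) × Equiv.Perm (Fin 4)) :=
  Finset.univ.filter fun x =>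
    x.2 0 < x.2 1 ∧ x.2 2 < x.2 3 ∧ reach x.1 (x.2 1) \ reach x.1 (x.2 0) = S.1

/-- The deficit angle at an edge: `2 π` minus the sum of the dihedral angles around it. -/
def deficit {n : Fin 3 → ℕ} (L : Edge n → ℝ) (e : Edge n) : ℝ :=
  2 * Real.pi - ∑ x ∈ around e.2,
    dihedral (metric L (tetAt e.1 x.1 (x.2 0)))
      (vec x.1 (x.2 0) (x.2 1)) (vec x.1 (x.2 0) (x.2 2)) (vec x.1 (x.2 0) (x.2 3))

/-- The part of the barycentric dual cell of vertex number `a` inside a tetrahedron of shape `σ`: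
the points at which the barycentric coordinate of that vertex is the largest, in block coordinates
relative to that vertex. -/
def cell (σ : Equiv.Perm (Fin 3)) (a : Fin 4) : Set (Fin 3 → ℝ) :=
  {x | ∃ t ∈ stdSimplex ℝ (Fin 4), (∀ b, t b ≤ t a) ∧ x = ∑ b, t b • vec σ a b}

/-- The volume of the barycentric dual cell of a vertex: the sum of the contributions of the 24
tetrahedra at the vertex. -/
def vertexVolume {n : Fin 3 → ℕ} (L : Edge n → ℝ) (v : Vertex n) : ℝ :=
  ∑ σ : Equiv.Perm (Fin 3), ∑ a : Fin 4,
    Real.sqrt (metric L (tetAt v σ a)).det * volume.real (cell σ a)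

/-- The volume of the part of the dual cell of `v` on the side, towards `d`, of the surface through
`v` orthogonal to `d`. -/
def cappedVolume {n : Fin 3 → ℕ} (L : Edge n → ℝ) (v : Vertex n) (d : Fin 3 → ℝ) : ℝ :=
  ∑ σ : Equiv.Perm (Fin 3), ∑ a : Fin 4,
    Real.sqrt (metric L (tetAt v σ a)).det *
      volume.real {x | x ∈ cell σ a ∧ 0 ≤ ip (metric L (tetAt v σ a)) x d}

/-- The volume associated with an edge: the union of the dual cells of its two ends, capped by the
surfaces orthogonal to the edge at each end. -/
def edgeVolume {n : Fin 3 → ℕ} (L : Edge n → ℝ) (e : Edge n) : ℝ :=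
  cappedVolume L e.1 (coord e.2.1) + cappedVolume L (e.1 + offset n e.2.1) (-coord e.2.1)

/-! ### Piecewise flat curvature and Ricci flow -/

/-- The scalar curvature at a vertex.  The sum is over the edges that start or end there. -/
def scalarCurv {n : Fin 3 → ℕ} (L : Edge n → ℝ) (v : Vertex n) : ℝ :=
  (∑ S : Dir, (L (v, S) * deficit L (v, S)
    + L (v - offset n S.1, S) * deficit L (v - offset n S.1, S))) / vertexVolume L v

/-- The contribution `½ |f| cos² θ ε_f` of an edge `f` to the sectional curvature orthogonal to the
edge `e`, where `e, f, g` are the sides of a triangle and `θ` is its angle between `e` and `f`. -/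
def curvTerm {n : Fin 3 → ℕ} (L : Edge n → ℝ) (e f g : Edge n) : ℝ :=
  1 / 2 * L f * ((L e ^ 2 + L f ^ 2 - L g ^ 2) / (2 * L e * L f)) ^ 2 * deficit L f

/-- The union of two directions. -/
def Dir.join (A B : Dir) : Dir := ⟨A.1 ∪ B.1, A.2.mono Finset.subset_union_left⟩

/-- The sum of the contributions to the sectional curvature orthogonal to `e` of the other two
sides of every triangle that contains `e`.  A triangle has vertices `u`, `u + A`, `u + (A ∪ B)`
with disjoint directions `A` and `B`, and `e` is its first, second or third side. -/
def triangleSum {n : Fin 3 → ℕ} (L : Edge n → ℝ) (e : Edge n) : ℝ :=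
  (∑ B : Dir with Disjoint e.2.1 B.1,
    (curvTerm L e (e.1 + offset n e.2.1, B) (e.1, e.2.join B)
      + curvTerm L e (e.1, e.2.join B) (e.1 + offset n e.2.1, B)))
  + (∑ A : Dir with Disjoint A.1 e.2.1,
    (curvTerm L e (e.1 - offset n A.1, A) (e.1 - offset n A.1, A.join e.2)
      + curvTerm L e (e.1 - offset n A.1, A.join e.2) (e.1 - offset n A.1, A)))
  + ∑ P : Dir × Dir with Disjoint P.1.1 P.2.1 ∧ P.1.join P.2 = e.2,
    (curvTerm L e (e.1, P.1) (e.1 + offset n P.1.1, P.2)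
      + curvTerm L e (e.1 + offset n P.1.1, P.2) (e.1, P.1))

/-- The sectional curvature orthogonal to an edge. -/
def sectionalCurv {n : Fin 3 → ℕ} (L : Edge n → ℝ) (e : Edge n) : ℝ :=
  (L e * deficit L e + triangleSum L e) / edgeVolume L e

/-- The Ricci curvature along an edge. -/
def ricci {n : Fin 3 → ℕ} (L : Edge n → ℝ) (e : Edge n) : ℝ :=
  1 / 4 * (scalarCurv L e.1 + scalarCurv L (e.1 + offset n e.2.1)) - sectionalCurv L e

/-- The piecewise flat Ricci flow is `d|ℓ|/dt = ricciFlow L ℓ`. -/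
def ricciFlow {n : Fin 3 → ℕ} (L : Edge n → ℝ) (e : Edge n) : ℝ := -(L e * ricci L e)

/-! ### Flat triangulations, flat blocks and the linearized flow -/

/-- The two types of block. -/
inductive BlockType
  | cubic
  | skew

/-- The edge vectors of a flat block of unit volume in the three coordinate directions. -/
def BlockType.frame : BlockType → Fin 3 → EuclideanSpace ℝ (Fin 3)
  | .cubic => ![!₂[1, 0, 0], !₂[0, 1, 0], !₂[0, 0, 1]]
  | .skew => ![!₂[1, -1 / 3, 0], !₂[0, 1, 0], !₂[-1 / 3, -2 / 9, 1]]

/-- The length of the edges of direction `S` in the flat triangulation by blocks of volume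
`c ^ 3`. -/
def flatLength (k : BlockType) (c : ℝ) (S : Dir) : ℝ := c * ‖∑ i ∈ S.1, k.frame i‖

/-- The face-diagonals. -/
abbrev FaceDiag (n : Fin 3 → ℕ) : Type := {e : Edge n // e.2.1.card = 2}

/-- The body-diagonal of a block. -/
def bodyDiag {n : Fin 3 → ℕ} (v : Vertex n) : Edge n := (v, ⟨Finset.univ, Finset.univ_nonempty⟩)

/-- The edge-lengths obtained from the flat triangulation by changing the length of each
face-diagonal `j` by `δ j` and giving the body-diagonal of each block `v` the length `b v`. -/
def lengths {n : Fin 3 → ℕ} (k : BlockType) (c : ℝ) (δ : FaceDiag n → ℝ) (b : Vertex n → ℝ) :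
    Edge n → ℝ := fun e =>
  if h : e.2.1.card = 2 then flatLength k c e.2 + δ ⟨e, h⟩
  else if e.2.1 = Finset.univ then b e.1
  else flatLength k c e.2

/-- `b` re-defines the body-diagonals in terms of the perturbations `δ` of the face-diagonals so
that all blocks are flat: the deficit angles at all body-diagonals are zero for all small enough
`δ`, and the lengths depend continuously on `δ` at `0`, with the original values there. -/
def IsFlatBlockRule {n : Fin 3 → ℕ} (k : BlockType) (c : ℝ)
    (b : (FaceDiag n → ℝ) → Vertex n → ℝ) : Prop :=
  (∀ v, b 0 v = flatLength k c (bodyDiag v).2) ∧ ContinuousAt b 0 ∧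
    ∀ᶠ δ in 𝓝 (0 : FaceDiag n → ℝ), ∀ v, deficit (lengths k c δ (b δ)) (bodyDiag v) = 0

/-- The same with the constraint linearized: the deficit angles at all body-diagonals are zero to
first order in `δ`. -/
def IsLinearFlatBlockRule {n : Fin 3 → ℕ} [∀ i, NeZero (n i)] (k : BlockType) (c : ℝ)
    (b : (FaceDiag n → ℝ) → Vertex n → ℝ) : Prop :=
  (∀ v, b 0 v = flatLength k c (bodyDiag v).2) ∧ ContinuousAt b 0 ∧
    ∀ v, (fun δ : FaceDiag n → ℝ => deficit (lengths k c δ (b δ)) (bodyDiag v)) =o[𝓝 0]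
      (fun δ : FaceDiag n → ℝ => δ)

/-- Rules that make the blocks exactly flat satisfy the linearized constraint. -/
theorem IsFlatBlockRule.linear {n : Fin 3 → ℕ} [∀ i, NeZero (n i)] {k : BlockType} {c : ℝ}
    {b : (FaceDiag n → ℝ) → Vertex n → ℝ} (h : IsFlatBlockRule k c b) :
    IsLinearFlatBlockRule k c b :=
  ⟨h.1, h.2.1, fun v => (isLittleO_zero _ _).congr'
    (h.2.2.mono fun _ hδ => (hδ v).symm) EventuallyEq.rfl⟩

/-- The rates of change `dδ_i/dt` of the face-diagonals under the piecewise flat Ricci flow, with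
the body-diagonals re-defined by `b`. -/
def faceFlow {n : Fin 3 → ℕ} (k : BlockType) (c : ℝ) (b : (FaceDiag n → ℝ) → Vertex n → ℝ)
    (δ : FaceDiag n → ℝ) (i : FaceDiag n) : ℝ :=
  ricciFlow (lengths k c δ (b δ)) i.1

/-- `A` is the coefficient matrix of the linearization `dδ/dt = A δ` of the system `dδ/dt = f δ` at
its stationary solution `δ = 0`. -/
def IsCoefficientMatrix {ι : Type*} [Fintype ι] [DecidableEq ι] (f : (ι → ℝ) → ι → ℝ)
    (A : Matrix ι ι ℝ) : Prop :=
  f 0 = 0 ∧ HasFDerivAt f (LinearMap.toContinuousLinearMap (Matrix.toLin' A)) 0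

end FlatBlocks

end

/-! A constant metric `g` on all blocks makes the torus flat, so every deficit angle of its
edge-lengths vanishes (`deficit_latticeLength`, from the angle sums in `sum_dihedral`). Let `w` be
constant on each of the three types of face-diagonal. With the coordinate edges kept, `w` is tangent
to the path of flat metrics `g + s • faceVariation g w`, along which all deficits stay zero.

The body-diagonals must also follow that path to first order. A body-diagonal is the only one in its
block, so the constraint is one scalar equation per block. The derivative of its deficit in its own
length is non-zero: for the six tetrahedra of any flat block, the rates of the dihedral angles add
up to a positive multiple of the squared length of the body-diagonal (`sum_bodyRate_ne_zero`). Hence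
`implicit_scalar` gives existence of a rule and differentiability at `0` of every rule, even for the
linearized constraint. The same non-vanishing makes the derivative of a rule along `w` equal to that
of the flat path (`IsLinearFlatBlockRule.fderiv_lengths`). So no deficit reacts to `w` to first
order.

All curvatures are sums of deficits with coefficients built from lengths, angles and volumes. The
deficits vanish at `δ = 0`, so these coefficients need only be continuous there
(`IsStationary.mul_left`); in particular the capped volumes need not be differentiated. The flow
inherits the vanishing derivative along `w`, and `w = 1` gives the row sums. -/

noncomputable section

namespace FlatBlocks

/-! ### The inner product with a given matrix -/

section ip

variable (g : Matrix (Fin 3) (Fin 3) ℝ) (u v w : Fin 3 → ℝ) (r : ℝ)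

theorem ip_add_left : ip g (u + v) w = ip g u w + ip g v w := by
  simp [ip, add_dotProduct]

theorem ip_add_right : ip g u (v + w) = ip g u v + ip g u w := by
  simp [ip, Matrix.mulVec_add, dotProduct_add]

theorem ip_sub_left : ip g (u - v) w = ip g u w - ip g v w := by
  simp [ip, sub_dotProduct]

theorem ip_sub_right : ip g u (v - w) = ip g u v - ip g u w := by
  simp [ip, Matrix.mulVec_sub, dotProduct_sub]

theorem ip_smul_left : ip g (r • u) w = r * ip g u w := by
  simp [ip, smul_dotProduct]

theorem ip_smul_right : ip g u (r • w) = r * ip g u w := by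
  simp [ip, Matrix.mulVec_smul, dotProduct_smul]

theorem ip_neg_right : ip g u (-w) = -ip g u w := by
  simp [ip, Matrix.mulVec_neg]

theorem ip_eq_sum : ip g u w = ∑ i, ∑ j, u i * g i j * w j := by
  simp [ip, dotProduct, Matrix.mulVec, Finset.mul_sum, mul_assoc]

theorem ip_comm {g : Matrix (Fin 3) (Fin 3) ℝ} (hg : g.IsHermitian) (u w : Fin 3 → ℝ) :
    ip g u w = ip g w u := by
  have h : ∀ i j, g i j = g j i := fun i j => by simpa using (hg.apply j i)
  rw [ip_eq_sum, ip_eq_sum, Finset.sum_comm]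
  refine Finset.sum_congr rfl fun i _ => Finset.sum_congr rfl fun j _ => ?_
  rw [h j i]; ring

theorem ip_pos {g : Matrix (Fin 3) (Fin 3) ℝ} (hg : g.PosDef) {u : Fin 3 → ℝ} (hu : u ≠ 0) :
    0 < ip g u u := by
  simpa [ip] using hg.dotProduct_mulVec_pos hu

end ip

/-- The inequalities between the inner products of three independent vectors which say that a
dihedral angle between them is well defined and strictly between `0` and `π`. -/
theorem gram_pos {g : Matrix (Fin 3) (Fin 3) ℝ} (hg : g.PosDef) {u p q : Fin 3 → ℝ}
    (h : LinearIndependent ℝ ![u, p, q]) :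
    0 < ip g u u ∧ 0 < ip g u u * ip g p p - ip g u p ^ 2 ∧
      0 < ip g u u * ip g q q - ip g u q ^ 2 ∧
      (ip g u u * ip g p q - ip g u p * ip g u q) ^ 2 <
        (ip g u u * ip g p p - ip g u p ^ 2) * (ip g u u * ip g q q - ip g u q ^ 2) := by
  have key : ∀ α β γ : ℝ, (α ≠ 0 ∨ β ≠ 0 ∨ γ ≠ 0) →
      0 < α ^ 2 * ip g u u + β ^ 2 * ip g p p + γ ^ 2 * ip g q q + 2 * α * β * ip g u p
        + 2 * α * γ * ip g u q + 2 * β * γ * ip g p q := by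
    intro α β γ hne
    have hx : α • u + β • p + γ • q ≠ 0 := by
      intro h0
      have := Fintype.linearIndependent_iff.1 h ![α, β, γ] (by simpa [Fin.sum_univ_three] using h0)
      have h0 := this 0; have h1 := this 1; have h2 := this 2
      simp at h0 h1 h2
      simp [h0, h1, h2] at hne
    have := ip_pos hg hx
    simp only [ip_add_left, ip_add_right, ip_smul_left, ip_smul_right] at this
    rw [ip_comm hg.1 p u, ip_comm hg.1 q u, ip_comm hg.1 q p] at this
    linarith
  have ha : 0 < ip g u u := by simpa using key 1 0 0 (by simp)
  have hX : 0 < ip g u u * ip g p p - ip g u p ^ 2 := by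
    -- These are the coefficients of `p` made orthogonal to `u`, scaled by `ip g u u` to avoid
    -- division.
    have := key (-ip g u p) (ip g u u) 0 (by simp [ha.ne'])
    refine pos_of_mul_pos_right (a := ip g u u) ?_ ha.le
    linarith
  have hY : 0 < ip g u u * ip g q q - ip g u q ^ 2 := by
    have := key (-ip g u q) 0 (ip g u u) (by simp [ha.ne'])
    refine pos_of_mul_pos_right (a := ip g u u) ?_ ha.le
    linarith
  refine ⟨ha, hX, hY, ?_⟩
  set X := ip g u u * ip g p p - ip g u p ^ 2 with hXd
  set Y := ip g u u * ip g q q - ip g u q ^ 2 with hYd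
  set N := ip g u u * ip g p q - ip g u p * ip g u q with hNd
  -- Second Gram–Schmidt step: `q` made orthogonal to both `u` and `p`, without denominators. Its
  -- squared norm is `ip g u u * X * (X * Y - N ^ 2)`.
  have := key (N * ip g u p - X * ip g u q) (-N * ip g u u) (X * ip g u u)
    (by simp [ha.ne', hX.ne'])
  rw [← sub_pos]
  refine pos_of_mul_pos_right (a := ip g u u * X) ?_ (mul_pos ha hX).le
  rw [hXd, hYd, hNd] at *
  nlinarith [this]

/-- Keeps the argument of `arccos` away from `±1`, the two points where it is not differentiable. -/
theorem abs_cos_lt_one {N X Y : ℝ} (hX : 0 < X) (hY : 0 < Y) (h : N ^ 2 < X * Y) :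
    N / (Real.sqrt X * Real.sqrt Y) ≠ -1 ∧ N / (Real.sqrt X * Real.sqrt Y) ≠ 1 := by
  have hs : (Real.sqrt X * Real.sqrt Y) ^ 2 = X * Y := by
    rw [mul_pow, Real.sq_sqrt hX.le, Real.sq_sqrt hY.le]
  have hpos : 0 < Real.sqrt X * Real.sqrt Y := by positivity
  have : |N / (Real.sqrt X * Real.sqrt Y)| < 1 := by
    rw [abs_div, abs_of_pos hpos, div_lt_one hpos]
    exact abs_lt_of_sq_lt_sq (by rw [hs]; exact h) hpos.le
  rw [abs_lt] at this
  exact ⟨this.1.ne', this.2.ne⟩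

theorem contDiffAt_ip {E : Type*} [NormedAddCommGroup E] [NormedSpace ℝ E]
    {M : E → Matrix (Fin 3) (Fin 3) ℝ} {x : E} (hM : ∀ i j, ContDiffAt ℝ 1 (fun y => M y i j) x)
    (u w : Fin 3 → ℝ) : ContDiffAt ℝ 1 (fun y => ip (M y) u w) x := by
  simp only [ip_eq_sum]
  exact ContDiffAt.sum fun i _ => ContDiffAt.sum fun j _ =>
    (contDiffAt_const.mul (hM i j)).mul contDiffAt_const

theorem contDiffAt_dihedral {E : Type*} [NormedAddCommGroup E] [NormedSpace ℝ E]
    {M : E → Matrix (Fin 3) (Fin 3) ℝ} {x : E} (hM : ∀ i j, ContDiffAt ℝ 1 (fun y => M y i j) x)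
    (hx : (M x).PosDef) {u p q : Fin 3 → ℝ} (h : LinearIndependent ℝ ![u, p, q]) :
    ContDiffAt ℝ 1 (fun y => dihedral (M y) u p q) x := by
  obtain ⟨ha, hX, hY, hN⟩ := gram_pos hx h
  obtain ⟨h1, h2⟩ := abs_cos_lt_one hX hY hN
  have hi := contDiffAt_ip hM
  have hd : ContDiffAt ℝ 1 (fun y => (ip (M y) u u * ip (M y) p q - ip (M y) u p * ip (M y) u q) /
    (Real.sqrt (ip (M y) u u * ip (M y) p p - ip (M y) u p ^ 2) *
      Real.sqrt (ip (M y) u u * ip (M y) q q - ip (M y) u q ^ 2))) x := by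
    refine ContDiffAt.div (((hi u u).mul (hi p q)).sub ((hi u p).mul (hi u q)))
      (ContDiffAt.mul (ContDiffAt.sqrt (((hi u u).mul (hi p p)).sub ((hi u p).pow 2)) hX.ne')
      (ContDiffAt.sqrt (((hi u u).mul (hi q q)).sub ((hi u q).pow 2)) hY.ne')) ?_
    have := Real.sqrt_pos.2 hX
    have := Real.sqrt_pos.2 hY
    positivity
  exact (Real.contDiffAt_arccos h1 h2).comp x hd

/-- The derivative of an angle given by its cosine in the form `N / (√X √Y)`. -/
theorem hasDerivAt_arccos_div {N X Y : ℝ → ℝ} {N' X' Y' x : ℝ} (hN : HasDerivAt N N' x)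
    (hX : HasDerivAt X X' x) (hY : HasDerivAt Y Y' x) (hX0 : 0 < X x) (hY0 : 0 < Y x)
    (h : N x ^ 2 < X x * Y x) :
    HasDerivAt (fun y => Real.arccos (N y / (Real.sqrt (X y) * Real.sqrt (Y y))))
      (-(N' - N x * X' / (2 * X x) - N x * Y' / (2 * Y x)) /
        Real.sqrt (X x * Y x - N x ^ 2)) x := by
  obtain ⟨h1, h2⟩ := abs_cos_lt_one hX0 hY0 h
  have hsX := Real.sqrt_pos.2 hX0
  have hsY := Real.sqrt_pos.2 hY0
  have hd := hN.div ((hX.sqrt hX0.ne').mul (hY.sqrt hY0.ne')) (mul_pos hsX hsY).ne'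
  have hc := (Real.hasDerivAt_arccos h1 h2).comp x hd
  refine hc.congr_deriv ?_
  have hZ : 0 < X x * Y x - N x ^ 2 := by linarith
  have e1 : Real.sqrt (1 - (N x / (Real.sqrt (X x) * Real.sqrt (Y x))) ^ 2) =
      Real.sqrt (X x * Y x - N x ^ 2) / (Real.sqrt (X x) * Real.sqrt (Y x)) := by
    rw [← Real.sqrt_mul hX0.le, ← Real.sqrt_div hZ.le]
    congr 1
    rw [div_pow, Real.sq_sqrt (by positivity)]
    field_simp
  simp only [Pi.mul_apply]
  rw [e1]
  have hsZ := Real.sqrt_pos.2 hZ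
  obtain ⟨a, ha⟩ : ∃ a, Real.sqrt (X x) = a := ⟨_, rfl⟩
  obtain ⟨b, hb⟩ : ∃ b, Real.sqrt (Y x) = b := ⟨_, rfl⟩
  have ha2 : X x = a ^ 2 := by rw [← ha, Real.sq_sqrt hX0.le]
  have hb2 : Y x = b ^ 2 := by rw [← hb, Real.sq_sqrt hY0.le]
  obtain ⟨z, hz⟩ : ∃ z, Real.sqrt (X x * Y x - N x ^ 2) = z := ⟨_, rfl⟩
  rw [hz, ha, hb]
  rw [ha] at hsX; rw [hb] at hsY; rw [hz] at hsZ
  rw [ha2, hb2]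
  field_simp
  ring

/-! ### Dihedral angles as angles between projections -/

-- The positive square root of `g` is such a map. It makes the theory of angles in Euclidean space
-- available for `g`.
open scoped MatrixOrder in
theorem exists_isometry {g : Matrix (Fin 3) (Fin 3) ℝ} (hg : g.PosDef) :
    ∃ φ : (Fin 3 → ℝ) →ₗ[ℝ] EuclideanSpace ℝ (Fin 3), ∀ u w, inner ℝ (φ u) (φ w) = ip g u w := by
  have hs : CFC.sqrt g * CFC.sqrt g = g := CFC.sqrt_mul_sqrt_self g hg.posSemidef.nonneg
  have hh : (CFC.sqrt g)ᵀ = CFC.sqrt g := by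
    simpa using (Matrix.nonneg_iff_posSemidef.1 (CFC.sqrt_nonneg g)).isHermitian.eq
  refine ⟨(WithLp.linearEquiv 2 ℝ (Fin 3 → ℝ)).symm.toLinearMap ∘ₗ Matrix.toLin' (CFC.sqrt g),
    fun u w => ?_⟩
  have h1 : inner ℝ (WithLp.toLp 2 (CFC.sqrt g *ᵥ u)) (WithLp.toLp 2 (CFC.sqrt g *ᵥ w))
      = (CFC.sqrt g *ᵥ w) ⬝ᵥ (CFC.sqrt g *ᵥ u) := by
    simp [EuclideanSpace.inner_eq_star_dotProduct]
  refine h1.trans ?_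
  rw [dotProduct_comm, ip, ← Matrix.vecMul_transpose, hh, ← Matrix.dotProduct_mulVec,
    Matrix.mulVec_mulVec, hs]

/-- The dihedral angle along `u` is the angle between projections along `u`. -/
theorem exists_dihedral_eq_angle {g : Matrix (Fin 3) (Fin 3) ℝ} (hg : g.PosDef) {u : Fin 3 → ℝ}
    (hu : u ≠ 0) :
    ∃ π : (Fin 3 → ℝ) →ₗ[ℝ] EuclideanSpace ℝ (Fin 3), π u = 0 ∧
      (∀ p, π p = 0 → ∃ r : ℝ, p = r • u) ∧
      ∀ p q, dihedral g u p q = InnerProductGeometry.angle (π p) (π q) := by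
  obtain ⟨φ, hφ⟩ := exists_isometry hg
  have ha := ip_pos hg hu
  -- Orthogonal projection along `u`, multiplied by `ip g u u`; angles do not see the factor.
  let π : (Fin 3 → ℝ) →ₗ[ℝ] EuclideanSpace ℝ (Fin 3) :=
    { toFun := fun p => φ (ip g u u • p - ip g u p • u)
      map_add' := fun p q => by
        rw [← map_add, ip_add_right]; congr 1; module
      map_smul' := fun r p => by
        rw [RingHom.id_apply, ← map_smul, ip_smul_right]; congr 1; module }
  have hπ : ∀ p q, inner ℝ (π p) (π q) =
      ip g u u * (ip g u u * ip g p q - ip g u p * ip g u q) := fun p q => by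
    change inner ℝ (φ _) (φ _) = _
    rw [hφ]
    simp only [ip_sub_left, ip_sub_right, ip_smul_left, ip_smul_right]
    rw [ip_comm hg.1 p u]
    ring
  have hn : ∀ p, ‖π p‖ =
      Real.sqrt (ip g u u) * Real.sqrt (ip g u u * ip g p p - ip g u p ^ 2) := fun p => by
    rw [norm_eq_sqrt_real_inner, hπ, ← Real.sqrt_mul ha.le, pow_two]
  refine ⟨π, ?_, fun p hp => ?_, fun p q => ?_⟩
  · change φ _ = 0
    rw [sub_self, map_zero]
  · have h0 : ip g (ip g u u • p - ip g u p • u) (ip g u u • p - ip g u p • u) = 0 := by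
      rw [← hφ]
      change inner ℝ (π p) (π p) = 0
      rw [hp, inner_zero_left]
    have h1 : ip g u u • p - ip g u p • u = 0 := by
      by_contra hne
      exact (ip_pos hg hne).ne' h0
    refine ⟨(ip g u u)⁻¹ * ip g u p, ?_⟩
    rw [mul_smul, ← sub_eq_zero.1 h1, smul_smul, inv_mul_cancel₀ ha.ne', one_smul]
  · rw [InnerProductGeometry.angle, dihedral, hπ, hn, hn]
    congr 1
    rw [mul_mul_mul_comm, Real.mul_self_sqrt ha.le, mul_div_mul_left _ _ ha.ne']

/-- The three angles are those of the triangle with sides `a`, `b`, `a + b`. -/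
theorem angle_hexagon {V : Type*} [NormedAddCommGroup V] [InnerProductSpace ℝ V] {a b : V}
    (ha : a ≠ 0) :
    InnerProductGeometry.angle a (a + b) + InnerProductGeometry.angle (a + b) b
      + InnerProductGeometry.angle b (-a) = Real.pi := by
  have := InnerProductGeometry.angle_add_angle_sub_add_angle_sub_eq_pi (a + b) ha
  rw [add_sub_cancel_left, show a - (a + b) = -b by abel] at this
  rw [InnerProductGeometry.angle_comm a (a + b), ← InnerProductGeometry.angle_neg_neg b (-a),
    neg_neg, InnerProductGeometry.angle_comm (-b)]
  exact this
/-! ### The tetrahedra around an edge -/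

/-- The vector between two vertices of a tetrahedron, with integer entries. -/
def vecInt (σ : Equiv.Perm (Fin 3)) (a b : Fin 4) : Fin 3 → ℤ := fun i =>
  (if i ∈ reach σ b then 1 else 0) - (if i ∈ reach σ a then 1 else 0)

/-- The linear map to the plane that takes the coordinate vectors to `R 0, R 1, R 2`. -/
def linkCoord (R : Fin 3 → ℤ × ℤ) (x : Fin 3 → ℤ) : ℤ × ℤ := ∑ i, x i • R i

/-- The link of an edge of direction `S` in the planar coordinates given by `R`, as a multiset of
segments. -/
def link (S : Dir) (R : Fin 3 → ℤ × ℤ) : Multiset (Sym2 (ℤ × ℤ)) :=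
  (around S).val.map fun x =>
    s(linkCoord R (vecInt x.1 (x.2 0) (x.2 2)), linkCoord R (vecInt x.1 (x.2 0) (x.2 3)))

/-- The boundary of the star of a vertex in the triangulation of the plane with edge directions
`(1, 0), (0, 1), (1, 1)`. -/
def hexagon : Multiset (Sym2 (ℤ × ℤ)) :=
  {s((1, 0), (1, 1)), s((1, 1), (0, 1)), s((0, 1), (-1, 0)),
    s((-1, 0), (-1, -1)), s((-1, -1), (0, -1)), s((0, -1), (1, 0))}

/-- The square with vertices `(±1, 0), (0, ±1)`. -/
def quadrilateral : Multiset (Sym2 (ℤ × ℤ)) :=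
  {s((1, 0), (0, 1)), s((0, 1), (-1, 0)), s((-1, 0), (0, -1)), s((0, -1), (1, 0))}

/-! ### The link of an edge -/

/-- In each case `R` annihilates the edge direction, so it is the projection of the block lattice
along the edge. Six tetrahedra meet at a coordinate edge or body-diagonal, four at a face-diagonal.
-/
theorem link_x : link ⟨{0}, by decide⟩ ![(0, 0), (1, 0), (0, 1)] = hexagon := by decide +kernel
theorem link_y : link ⟨{1}, by decide⟩ ![(1, 0), (0, 0), (0, 1)] = hexagon := by decide +kernel
theorem link_z : link ⟨{2}, by decide⟩ ![(1, 0), (0, 1), (0, 0)] = hexagon := by decide +kernel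
theorem link_yz : link ⟨{1, 2}, by decide⟩ ![(0, 1), (1, 0), (-1, 0)] = quadrilateral := by
  decide +kernel
theorem link_xz : link ⟨{0, 2}, by decide⟩ ![(1, 0), (0, 1), (-1, 0)] = quadrilateral := by
  decide +kernel
theorem link_xy : link ⟨{0, 1}, by decide⟩ ![(1, 0), (-1, 0), (0, 1)] = quadrilateral := by
  decide +kernel
theorem link_xyz : link ⟨{0, 1, 2}, by decide⟩ ![(1, 0), (0, 1), (-1, -1)] = hexagon := by
  decide +kernel

/-! ### Vectors between the vertices of a tetrahedron -/

theorem reach_mono (σ : Equiv.Perm (Fin 3)) {a b : Fin 4} (h : a ≤ b) : reach σ a ⊆ reach σ b :=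
  fun _ hi => by
    simp only [reach, Finset.mem_filter, Finset.mem_univ, true_and] at hi ⊢
    exact hi.trans_le h

theorem vec_eq_coord (σ : Equiv.Perm (Fin 3)) {a b : Fin 4} (h : a ≤ b) :
    vec σ a b = coord (reach σ b \ reach σ a) := by
  ext i
  have := @reach_mono σ a b h i
  by_cases h1 : i ∈ reach σ a <;> by_cases h2 : i ∈ reach σ b <;> simp_all [vec, coord]

theorem vec_eq_intCast (σ : Equiv.Perm (Fin 3)) (a b : Fin 4) :
    vec σ a b = fun i => (vecInt σ a b i : ℝ) := by
  ext i
  by_cases h1 : i ∈ reach σ a <;> by_cases h2 : i ∈ reach σ b <;> simp [vec, coord, vecInt, h1, h2]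

theorem vec_neg (σ : Equiv.Perm (Fin 3)) (a b : Fin 4) : vec σ b a = -vec σ a b := by
  simp [vec]

theorem vec_of_mem_around {S : Dir} {x : Equiv.Perm (Fin 3) × Equiv.Perm (Fin 4)}
    (hx : x ∈ around S) : vec x.1 (x.2 0) (x.2 1) = coord S.1 := by
  simp only [around, Finset.mem_filter, Finset.mem_univ, true_and] at hx
  rw [vec_eq_coord _ hx.1.le, hx.2.2]

theorem coord_ne_zero (S : Dir) : coord S.1 ≠ 0 := by
  obtain ⟨i, hi⟩ := S.2
  intro h
  have := congrFun h i
  simp [coord, hi] at this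

/-! ### Angle sums -/

section angles

variable {V : Type*} [NormedAddCommGroup V] [InnerProductSpace ℝ V]

/-- The angle between two vectors of the plane spanned by `A` and `B`. -/
def planeAngle (A B : V) : Sym2 (ℤ × ℤ) → ℝ :=
  Sym2.lift ⟨fun x y => InnerProductGeometry.angle ((x.1 : ℝ) • A + (x.2 : ℝ) • B)
    ((y.1 : ℝ) • A + (y.2 : ℝ) • B), fun _ _ => InnerProductGeometry.angle_comm _ _⟩

/-- The hexagon is centrally symmetric; each half contributes `π` by `angle_hexagon`. -/
theorem sum_planeAngle_hexagon {A : V} (hA : A ≠ 0) (B : V) :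
    (hexagon.map (planeAngle A B)).sum = 2 * Real.pi := by
  have h1 := angle_hexagon (b := B) hA
  have h2 := angle_hexagon (b := -B) (neg_ne_zero.2 hA)
  simp only [hexagon, Multiset.insert_eq_cons, Multiset.map_cons, Multiset.map_singleton,
    Multiset.sum_cons, Multiset.sum_singleton, planeAngle, Sym2.lift_mk]
  simp only [Int.cast_one, Int.cast_zero, Int.cast_neg, one_smul, zero_smul, neg_smul, add_zero,
    zero_add]
  rw [neg_neg] at h2
  linarith

/-- Neighbouring angles are supplementary, and this holds for zero vectors too, whose angles are `π
/ 2` by convention. -/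
theorem sum_planeAngle_quadrilateral (A B : V) :
    (quadrilateral.map (planeAngle A B)).sum = 2 * Real.pi := by
  simp only [quadrilateral, Multiset.insert_eq_cons, Multiset.map_cons, Multiset.map_singleton,
    Multiset.sum_cons, Multiset.sum_singleton, planeAngle, Sym2.lift_mk]
  simp only [Int.cast_one, Int.cast_zero, Int.cast_neg, one_smul, zero_smul, neg_smul, add_zero,
    zero_add, InnerProductGeometry.angle_neg_right, InnerProductGeometry.angle_neg_left,
    InnerProductGeometry.angle_comm B A]
  ring

/-- Separates combinatorics from geometry: `π` factors through the integer map `R`, so the angles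
depend on the tetrahedra only through the segments of the link. -/
theorem sum_angle_eq_link (S : Dir) (R : Fin 3 → ℤ × ℤ) (π : (Fin 3 → ℝ) →ₗ[ℝ] V) (A B : V)
    (hπ : ∀ i, π (Pi.single i 1) = ((R i).1 : ℝ) • A + ((R i).2 : ℝ) • B) :
    ∑ x ∈ around S, InnerProductGeometry.angle (π (vec x.1 (x.2 0) (x.2 2)))
      (π (vec x.1 (x.2 0) (x.2 3))) = ((link S R).map (planeAngle A B)).sum := by
  have h : ∀ x : Fin 3 → ℤ, π (fun i => (x i : ℝ)) =
      ((linkCoord R x).1 : ℝ) • A + ((linkCoord R x).2 : ℝ) • B := fun x => by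
    have : (fun i => (x i : ℝ)) = ∑ i, (x i : ℝ) • (Pi.single i 1 : Fin 3 → ℝ) := by
      ext j
      simp [Finset.sum_apply, Pi.single_apply]
    rw [this, map_sum]
    simp only [map_smul, hπ, linkCoord, Prod.fst_sum, Prod.snd_sum, Prod.smul_fst, Prod.smul_snd,
      Int.cast_sum, Finset.sum_smul, smul_eq_mul, Int.cast_mul, ← Finset.sum_add_distrib, smul_add,
      smul_smul]
  rw [link, Multiset.map_map]
  refine Finset.sum_congr rfl fun x _ => ?_
  simp only [Function.comp, planeAngle, Sym2.lift_mk, vec_eq_intCast, h]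

end angles

theorem single_ne_smul_coord_of_mem {S : Finset (Fin 3)} {j k : Fin 3} (hk : k ∈ S)
    (hjk : k ≠ j) :
    ¬ ∃ r : ℝ, (Pi.single j 1 : Fin 3 → ℝ) = r • coord S := by
  rintro ⟨r, hr⟩
  have h1 := congrFun hr j
  have h2 := congrFun hr k
  simp [coord, hk, hjk] at h1 h2
  rw [← h2] at h1
  simp at h1

theorem dir_cases (S : Dir) : S.1 = {0} ∨ S.1 = {1} ∨ S.1 = {2} ∨ S.1 = {1, 2} ∨ S.1 = {0, 2} ∨
    S.1 = {0, 1} ∨ S.1 = {0, 1, 2} := by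
  revert S; decide

theorem coord_eq_sum (S : Finset (Fin 3)) :
    coord S = ∑ i ∈ S, (Pi.single i 1 : Fin 3 → ℝ) := by
  ext j
  simp [coord, Finset.sum_apply, Pi.single_apply]

/-- In a triangulation with the same metric in all tetrahedra, the dihedral angles at each edge
add up to `2 π`. -/
theorem sum_dihedral {g : Matrix (Fin 3) (Fin 3) ℝ} (hg : g.PosDef) (S : Dir) :
    ∑ x ∈ around S, dihedral g (vec x.1 (x.2 0) (x.2 1)) (vec x.1 (x.2 0) (x.2 2))
      (vec x.1 (x.2 0) (x.2 3)) = 2 * Real.pi := by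
  obtain ⟨π, hπu, hπ0, hπ⟩ := exists_dihedral_eq_angle hg (coord_ne_zero S)
  have : ∑ x ∈ around S, dihedral g (vec x.1 (x.2 0) (x.2 1)) (vec x.1 (x.2 0) (x.2 2))
      (vec x.1 (x.2 0) (x.2 3)) = ∑ x ∈ around S, InnerProductGeometry.angle
        (π (vec x.1 (x.2 0) (x.2 2))) (π (vec x.1 (x.2 0) (x.2 3))) :=
    Finset.sum_congr rfl fun x hx => by rw [vec_of_mem_around hx, hπ]
  rw [this]
  have hne : ∀ j k, k ∈ S.1 → k ≠ j → π (Pi.single j 1) ≠ 0 := fun j k hk hkj h =>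
    single_ne_smul_coord_of_mem hk hkj (hπ0 _ h)
  -- The relation `π u = 0` expresses all projected coordinate vectors through two of them, with the
  -- coefficients recorded in the matching `R`.
  rw [coord_eq_sum, map_sum] at hπu
  obtain ⟨S, hS⟩ := S
  rcases dir_cases ⟨S, hS⟩ with h | h | h | h | h | h | h <;> dsimp only at h hπu hne <;> subst h
  · rw [sum_angle_eq_link _ _ π (π (Pi.single 1 1)) (π (Pi.single 2 1)) ?_, link_x,
      sum_planeAngle_hexagon (hne _ 0 (by decide) (by decide))]
    simp at hπu
    intro i; fin_cases i <;> simp [hπu]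
  · rw [sum_angle_eq_link _ _ π (π (Pi.single 0 1)) (π (Pi.single 2 1)) ?_, link_y,
      sum_planeAngle_hexagon (hne _ 1 (by decide) (by decide))]
    simp at hπu
    intro i; fin_cases i <;> simp [hπu]
  · rw [sum_angle_eq_link _ _ π (π (Pi.single 0 1)) (π (Pi.single 1 1)) ?_, link_z,
      sum_planeAngle_hexagon (hne _ 2 (by decide) (by decide))]
    simp at hπu
    intro i; fin_cases i <;> simp [hπu]
  · rw [sum_angle_eq_link _ _ π (π (Pi.single 1 1)) (π (Pi.single 0 1)) ?_, link_yz,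
      sum_planeAngle_quadrilateral]
    rw [Finset.sum_pair (by decide), add_comm] at hπu
    intro i; fin_cases i <;> simp [eq_neg_of_add_eq_zero_left hπu]
  · rw [sum_angle_eq_link _ _ π (π (Pi.single 0 1)) (π (Pi.single 1 1)) ?_, link_xz,
      sum_planeAngle_quadrilateral]
    rw [Finset.sum_pair (by decide), add_comm] at hπu
    intro i; fin_cases i <;> simp [eq_neg_of_add_eq_zero_left hπu]
  · rw [sum_angle_eq_link _ _ π (π (Pi.single 0 1)) (π (Pi.single 2 1)) ?_, link_xy,
      sum_planeAngle_quadrilateral]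
    rw [Finset.sum_pair (by decide), add_comm] at hπu
    intro i; fin_cases i <;> simp [eq_neg_of_add_eq_zero_left hπu]
  · rw [sum_angle_eq_link _ _ π (π (Pi.single 0 1)) (π (Pi.single 1 1)) ?_, link_xyz,
      sum_planeAngle_hexagon (hne _ 1 (by decide) (by decide))]
    rw [Finset.sum_insert (by decide), Finset.sum_pair (by decide), ← add_assoc, add_comm] at hπu
    intro i; fin_cases i <;> simp [eq_neg_of_add_eq_zero_left hπu, add_comm]

/-! ### Translation-invariant metrics -/

/-- The length of the edges of direction `S` in the triangulation of the torus with the flat metric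
`g`. -/
def latticeLength (g : Matrix (Fin 3) (Fin 3) ℝ) (S : Dir) : ℝ :=
  Real.sqrt (ip g (coord S.1) (coord S.1))

theorem latticeLength_pos {g : Matrix (Fin 3) (Fin 3) ℝ} (hg : g.PosDef) (S : Dir) :
    0 < latticeLength g S :=
  Real.sqrt_pos.2 (ip_pos hg (coord_ne_zero S))

theorem sq_latticeLength {g : Matrix (Fin 3) (Fin 3) ℝ} (hg : g.PosDef) (S : Dir) :
    latticeLength g S ^ 2 = ip g (coord S.1) (coord S.1) :=
  Real.sq_sqrt (ip_pos hg (coord_ne_zero S)).le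

theorem ip_neg_neg (g : Matrix (Fin 3) (Fin 3) ℝ) (u w : Fin 3 → ℝ) :
    ip g (-u) (-w) = ip g u w := by
  simp [ip, Matrix.mulVec_neg]

theorem ip_single (g : Matrix (Fin 3) (Fin 3) ℝ) (i j : Fin 3) :
    ip g (Pi.single i 1) (Pi.single j 1) = g i j := by
  simp [ip]

theorem le_of_reach_diff_nonempty {σ : Equiv.Perm (Fin 3)} {a b : Fin 4}
    (h : (reach σ b \ reach σ a).Nonempty) : a ≤ b := by
  by_contra hlt
  rw [Finset.sdiff_eq_empty_iff_subset.2 (reach_mono σ (not_le.1 hlt).le)] at h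
  exact Finset.not_nonempty_empty h

/-- The sides of a tetrahedron have the lengths of the vectors between its vertices if its edges
do. -/
theorem sq_side {n : Fin 3 → ℕ} {L : Edge n → ℝ} {T : Tet n} {g : Matrix (Fin 3) (Fin 3) ℝ}
    (h : ∀ (a b : Fin 4) (hab : (reach T.2 b \ reach T.2 a).Nonempty),
      L (T.1 + offset n (reach T.2 a), ⟨reach T.2 b \ reach T.2 a, hab⟩) ^ 2
        = ip g (vec T.2 a b) (vec T.2 a b)) (a b : Fin 4) :
    side L T a b ^ 2 = ip g (vec T.2 a b) (vec T.2 a b) := by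
  unfold side
  split_ifs with h1 h2
  · exact h a b h1
  · rw [vec_neg T.2 b a, ip_neg_neg]
    exact h b a h2
  · have h1 := Finset.sdiff_eq_empty_iff_subset.1 (Finset.not_nonempty_iff_eq_empty.1 h1)
    have h2 := Finset.sdiff_eq_empty_iff_subset.1 (Finset.not_nonempty_iff_eq_empty.1 h2)
    simp [vec, h1.antisymm h2, ip]

theorem vec_step (σ : Equiv.Perm (Fin 3)) (i : Fin 3) :
    vec σ (σ.symm i).castSucc (σ.symm i).succ = Pi.single i 1 := by
  ext k
  simp only [vec, coord, reach, Finset.mem_filter, Finset.mem_univ, true_and, Pi.sub_apply,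
    Fin.castSucc_lt_succ_iff, Fin.castSucc_lt_castSucc_iff, Pi.single_apply]
  rcases lt_trichotomy (σ.symm k) (σ.symm i) with h | h | h
  · have : k ≠ i := by rintro rfl; exact lt_irrefl _ h
    simp [h, h.le, this]
  · have := σ.symm.injective h
    simp [this]
  · have h' : k ≠ i := by rintro rfl; exact lt_irrefl _ h
    simp [h.not_ge, h.not_gt, h']

/-- Polarization: the entries of `metric` recover inner products from the squared distances of four
vertices. -/
theorem metric_eq {n : Fin 3 → ℕ} {L : Edge n → ℝ} {T : Tet n} {g : Matrix (Fin 3) (Fin 3) ℝ}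
    (hg : g.IsHermitian)
    (h : ∀ a b, side L T a b ^ 2 = ip g (vec T.2 a b) (vec T.2 a b)) : metric L T = g := by
  ext i j
  simp only [metric, Matrix.of_apply, h]
  rw [← ip_single g i j, ← vec_step T.2 i, ← vec_step T.2 j]
  simp only [vec, ip_sub_left, ip_sub_right]
  have := ip_comm hg
  rw [this (coord (reach T.2 (T.2.symm j).succ)) (coord (reach T.2 (T.2.symm i).castSucc)),
    this (coord (reach T.2 (T.2.symm j).castSucc)) (coord (reach T.2 (T.2.symm i).succ)),
    this (coord (reach T.2 (T.2.symm j).castSucc)) (coord (reach T.2 (T.2.symm i).castSucc)),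
    this (coord (reach T.2 (T.2.symm j).succ)) (coord (reach T.2 (T.2.symm i).succ))]
  ring

theorem metric_latticeLength {n : Fin 3 → ℕ} {g : Matrix (Fin 3) (Fin 3) ℝ} (hg : g.PosDef)
    (T : Tet n) : metric (fun e : Edge n => latticeLength g e.2) T = g :=
  metric_eq hg.1 <| sq_side fun a b hab => by
    rw [sq_latticeLength hg, vec_eq_coord _ (le_of_reach_diff_nonempty hab)]

/-- All tetrahedra carry the same metric, so the angles close up. This holds for every positive
definite `g`, which supplies the flat directions of deformation. -/
theorem deficit_latticeLength {n : Fin 3 → ℕ} {g : Matrix (Fin 3) (Fin 3) ℝ} (hg : g.PosDef)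
    (e : Edge n) : deficit (fun e : Edge n => latticeLength g e.2) e = 0 := by
  simp only [deficit, metric_latticeLength hg, sum_dihedral hg, sub_self]

/-! ### Smoothness of the deficit angles -/

theorem det_vecInt_ne_zero (σ : Equiv.Perm (Fin 3)) (τ : Equiv.Perm (Fin 4)) :
    (Matrix.of fun i : Fin 3 => vecInt σ (τ 0) (τ i.succ)).det ≠ 0 := by
  revert σ τ
  decide +kernel

theorem linearIndependent_vec (σ : Equiv.Perm (Fin 3)) (τ : Equiv.Perm (Fin 4)) :
    LinearIndependent ℝ ![vec σ (τ 0) (τ 1), vec σ (τ 0) (τ 2), vec σ (τ 0) (τ 3)] := by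
  set M : Matrix (Fin 3) (Fin 3) ℤ := Matrix.of fun i : Fin 3 => vecInt σ (τ 0) (τ i.succ) with hM
  have hd : ((Int.castRingHom ℝ).mapMatrix M).det ≠ 0 := by
    rw [← RingHom.map_det]
    simpa using det_vecInt_ne_zero σ τ
  have : LinearIndependent ℝ ((Int.castRingHom ℝ).mapMatrix M).row :=
    Matrix.linearIndependent_rows_of_det_ne_zero hd
  convert this using 1
  ext i j
  fin_cases i <;> simp [hM, vec_eq_intCast, Matrix.row]

theorem contDiff_side {n : Fin 3 → ℕ} [∀ i, NeZero (n i)] (T : Tet n) (a b : Fin 4) :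
    ContDiff ℝ 1 fun L : Edge n → ℝ => side L T a b := by
  unfold side
  split_ifs
  · exact contDiff_apply ℝ ℝ _
  · exact contDiff_apply ℝ ℝ _
  · exact contDiff_const

theorem contDiff_metric {n : Fin 3 → ℕ} [∀ i, NeZero (n i)] (T : Tet n) (i j : Fin 3) :
    ContDiff ℝ 1 fun L : Edge n → ℝ => metric L T i j := by
  have h := contDiff_side T
  simp only [metric, Matrix.of_apply]
  exact (((((h _ _).pow 2).add ((h _ _).pow 2)).sub ((h _ _).pow 2)).sub ((h _ _).pow 2)).div_const _

theorem contDiffAt_deficit {n : Fin 3 → ℕ} [∀ i, NeZero (n i)] {L : Edge n → ℝ}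
    (hL : ∀ T, (metric L T).PosDef) (e : Edge n) :
    ContDiffAt ℝ 1 (fun L : Edge n → ℝ => deficit L e) L :=
  contDiffAt_const.sub <| ContDiffAt.sum fun x _ =>
    contDiffAt_dihedral (fun i j => (contDiff_metric _ i j).contDiffAt) (hL _)
      (linearIndependent_vec x.1 x.2)

/-! ### The flat metric of a block -/

/-- The Euclidean metric of the flat blocks in block coordinates. -/
def flatMetric (k : BlockType) (c : ℝ) : Matrix (Fin 3) (Fin 3) ℝ :=
  Matrix.of fun i j => c ^ 2 * inner ℝ (k.frame i) (k.frame j)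

theorem ip_flatMetric (k : BlockType) (c : ℝ) (x : Fin 3 → ℝ) :
    ip (flatMetric k c) x x = (c * ‖∑ i, x i • k.frame i‖) ^ 2 := by
  rw [mul_pow, ← real_inner_self_eq_norm_sq, ip_eq_sum]
  simp only [sum_inner, inner_sum, inner_smul_left, inner_smul_right, Finset.mul_sum, flatMetric,
    Matrix.of_apply]
  refine Finset.sum_congr rfl fun i _ => Finset.sum_congr rfl fun j _ => ?_
  rw [real_inner_comm]; simp; ring

theorem frame_combination_ne_zero (k : BlockType) {x : Fin 3 → ℝ} (hx : x ≠ 0) :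
    ∑ i, x i • k.frame i ≠ 0 := by
  intro h
  apply hx
  have h0 := congrFun (congrArg WithLp.ofLp h) 0
  have h1 := congrFun (congrArg WithLp.ofLp h) 1
  have h2 := congrFun (congrArg WithLp.ofLp h) 2
  cases k <;> simp [BlockType.frame, Fin.sum_univ_three] at h0 h1 h2 <;> ext i <;> fin_cases i <;>
    simp <;> linarith

theorem posDef_flatMetric (k : BlockType) {c : ℝ} (hc : 0 < c) : (flatMetric k c).PosDef := by
  refine .of_dotProduct_mulVec_pos ?_ fun x hx => ?_
  · ext i j
    simp [flatMetric, real_inner_comm]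
  · have : 0 < ip (flatMetric k c) x x := by
      rw [ip_flatMetric]
      have := norm_pos_iff.2 (frame_combination_ne_zero k hx)
      positivity
    simpa [ip] using this

theorem flatLength_eq (k : BlockType) {c : ℝ} (hc : 0 < c) (S : Dir) :
    flatLength k c S = latticeLength (flatMetric k c) S := by
  rw [latticeLength, ip_flatMetric, Real.sqrt_sq (by positivity), flatLength]
  simp [coord, Finset.sum_ite_mem]

theorem lengths_zero {n : Fin 3 → ℕ} (k : BlockType) {c : ℝ} (hc : 0 < c) {b : Vertex n → ℝ}
    (hb : ∀ v, b v = flatLength k c (bodyDiag v).2) :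
    lengths k c 0 b = fun e => latticeLength (flatMetric k c) e.2 := by
  ext ⟨v, S, hS⟩
  rw [← flatLength_eq k hc]
  simp only [lengths, Pi.zero_apply, add_zero, dite_eq_ite]
  split_ifs with h1 h2
  · rfl
  · subst h2; exact hb v
  · rfl

/-! ### Changing the length of a body-diagonal -/

/-- The metric of a tetrahedron of shape `σ` after adding `2 t` to the square of the length of its
body-diagonal. -/
def stretch (σ : Equiv.Perm (Fin 3)) (g : Matrix (Fin 3) (Fin 3) ℝ) (t : ℝ) :
    Matrix (Fin 3) (Fin 3) ℝ :=
  g + t • (Matrix.single (σ 0) (σ 2) 1 + Matrix.single (σ 2) (σ 0) 1)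

theorem ip_stretch (σ : Equiv.Perm (Fin 3)) (g : Matrix (Fin 3) (Fin 3) ℝ) (t : ℝ)
    (x y : Fin 3 → ℝ) :
    ip (stretch σ g t) x y = ip g x y + t * (x (σ 0) * y (σ 2) + x (σ 2) * y (σ 0)) := by
  have h : ∀ i j : Fin 3, x ⬝ᵥ (Matrix.single i j (1 : ℝ) *ᵥ y) = x i * y j := fun i j => by
    rw [Matrix.single_mulVec]
    simp [dotProduct, Function.update_apply]
  simp only [ip, stretch, Matrix.add_mulVec, Matrix.smul_mulVec, dotProduct_add, dotProduct_smul, h,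
    smul_eq_mul]

theorem isHermitian_stretch (σ : Equiv.Perm (Fin 3)) {g : Matrix (Fin 3) (Fin 3) ℝ}
    (hg : g.IsHermitian) (t : ℝ) : (stretch σ g t).IsHermitian := by
  rw [Matrix.IsHermitian, stretch, Matrix.conjTranspose_add, hg.eq, Matrix.conjTranspose_smul,
    Matrix.conjTranspose_add, Matrix.conjTranspose_single, Matrix.conjTranspose_single]
  simp [add_comm]

theorem reach_diff_eq_univ : ∀ (σ : Equiv.Perm (Fin 3)) (a b : Fin 4),
    reach σ b \ reach σ a = Finset.univ ↔ a = 0 ∧ b = 3 := by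
  decide +kernel

/-- An edge of the tetrahedron covers consecutive steps of the walk, so only the body-diagonal
contains both the first and the last. This is why `stretch` changes no other edge. -/
theorem reach_diff_mem : ∀ (σ : Equiv.Perm (Fin 3)) (a b : Fin 4),
    σ 0 ∈ reach σ b \ reach σ a → σ 2 ∈ reach σ b \ reach σ a → a = 0 ∧ b = 3 := by
  decide +kernel

theorem reach_zero (σ : Equiv.Perm (Fin 3)) : reach σ 0 = ∅ := by
  simp [reach]

theorem offset_empty (n : Fin 3 → ℕ) : offset n ∅ = 0 := by
  ext; simp [offset]

theorem metric_lengths_zero {n : Fin 3 → ℕ} (k : BlockType) {c : ℝ} (hc : 0 < c) (b : Vertex n → ℝ)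
    (v : Vertex n) (σ : Equiv.Perm (Fin 3)) :
    metric (lengths k c 0 b) (v, σ) =
      stretch σ (flatMetric k c) ((b v ^ 2 - flatLength k c (bodyDiag v).2 ^ 2) / 2) := by
  have hg := posDef_flatMetric k hc
  refine metric_eq (isHermitian_stretch σ hg.1 _) (sq_side fun a b' hab => ?_)
  rw [vec_eq_coord _ (le_of_reach_diff_nonempty hab), ip_stretch]
  simp only [lengths, Pi.zero_apply, add_zero, dite_eq_ite]
  by_cases h : reach σ b' \ reach σ a = Finset.univ
  · obtain ⟨rfl, rfl⟩ := (reach_diff_eq_univ σ a b').1 h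
    have h3 : reach σ 3 = Finset.univ := by simpa [reach_zero] using h
    simp [reach_zero, h3, flatLength_eq k hc, sq_latticeLength hg, bodyDiag, offset_empty, coord]
    ring
  · have h' : coord (reach σ b' \ reach σ a) (σ 0) * coord (reach σ b' \ reach σ a) (σ 2) = 0 := by
      by_contra hne
      refine h ((reach_diff_eq_univ σ a b').2 (reach_diff_mem σ a b' ?_ ?_)) <;> by_contra hmem <;>
        simp [coord, hmem] at hne
    rw [if_neg h, ite_self, flatLength_eq k hc, sq_latticeLength hg, mul_comm (coord _ (σ 2)), h']
    simp

/-- The numbering of the vertices of a tetrahedron that starts with the ends of its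
body-diagonal. -/
def bodyListing : Equiv.Perm (Fin 4) := ⟨![0, 3, 1, 2], ![0, 2, 3, 1], by decide, by decide⟩

theorem around_univ : around ⟨Finset.univ, Finset.univ_nonempty⟩ =
    Finset.univ.image fun σ => (σ, bodyListing) := by
  decide +kernel

theorem vecInt_zero_three : ∀ σ : Equiv.Perm (Fin 3), vecInt σ 0 3 = fun _ => 1 := by
  decide +kernel

theorem vecInt_zero_one : ∀ σ : Equiv.Perm (Fin 3), vecInt σ 0 1 = Pi.single (σ 0) 1 := by
  decide +kernel

theorem vecInt_zero_two : ∀ σ : Equiv.Perm (Fin 3),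
    vecInt σ 0 2 = Pi.single (σ 0) 1 + Pi.single (σ 1) 1 := by
  decide +kernel

theorem deficit_bodyDiag {n : Fin 3 → ℕ} (L : Edge n → ℝ) (v : Vertex n) :
    deficit L (bodyDiag v) = 2 * Real.pi - ∑ σ : Equiv.Perm (Fin 3),
      dihedral (metric L (v, σ)) (vec σ 0 3) (vec σ 0 1) (vec σ 0 2) := by
  have h0 : bodyListing 0 = 0 := rfl
  have h1 : bodyListing 1 = 3 := rfl
  have h2 : bodyListing 2 = 1 := rfl
  have h3 : bodyListing 3 = 2 := rfl
  rw [deficit, bodyDiag]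
  simp only [around_univ]
  rw [Finset.sum_image fun _ _ _ _ h => (Prod.ext_iff.1 h).1]
  simp only [h0, h1, h2, h3, tetAt, reach_zero, offset_empty, sub_zero]

theorem linearIndependent_body (σ : Equiv.Perm (Fin 3)) :
    LinearIndependent ℝ ![vec σ 0 3, vec σ 0 1, vec σ 0 2] :=
  linearIndependent_vec σ bodyListing

theorem sum_perm_fin_three (F : Fin 3 → Fin 3 → Fin 3 → ℝ) :
    ∑ σ : Equiv.Perm (Fin 3), F (σ 0) (σ 1) (σ 2) =
      F 0 1 2 + F 0 2 1 + F 1 0 2 + F 1 2 0 + F 2 0 1 + F 2 1 0 := by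
  have h : (Finset.univ : Finset (Equiv.Perm (Fin 3))).val.map (fun σ => (σ 0, σ 1, σ 2)) =
      {(0, 1, 2), (0, 2, 1), (1, 0, 2), (1, 2, 0), (2, 0, 1), (2, 1, 0)} := by
    decide +kernel
  have := congrArg (fun m => (m.map fun x : Fin 3 × Fin 3 × Fin 3 => F x.1 x.2.1 x.2.2).sum) h
  simp only [Multiset.map_map] at this
  refine Eq.trans this ?_
  simp [Multiset.insert_eq_cons, add_assoc]

/-- The derivative at `t = 0` of the dihedral angle along the body-diagonal `u` between `p` and `q`
in a tetrahedron of shape `σ` with metric `stretch σ g t`. -/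
def bodyRate (g : Matrix (Fin 3) (Fin 3) ℝ) (u p q : Fin 3 → ℝ) : ℝ :=
  -(2 * ip g p q - (ip g u p + ip g u q)
      - (ip g u u * ip g p q - ip g u p * ip g u q) * (2 * ip g p p - 2 * ip g u p) /
        (2 * (ip g u u * ip g p p - ip g u p ^ 2))
      - (ip g u u * ip g p q - ip g u p * ip g u q) * (2 * ip g q q - 2 * ip g u q) /
        (2 * (ip g u u * ip g q q - ip g u q ^ 2))) /
    Real.sqrt ((ip g u u * ip g p p - ip g u p ^ 2) * (ip g u u * ip g q q - ip g u q ^ 2)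
      - (ip g u u * ip g p q - ip g u p * ip g u q) ^ 2)

theorem hasDerivAt_dihedral_stretch {g : Matrix (Fin 3) (Fin 3) ℝ} (hg : g.PosDef)
    (σ : Equiv.Perm (Fin 3)) :
    HasDerivAt (fun t => dihedral (stretch σ g t) (vec σ 0 3) (vec σ 0 1) (vec σ 0 2))
      (bodyRate g (vec σ 0 3) (vec σ 0 1) (vec σ 0 2)) 0 := by
  obtain ⟨ha, hX, hY, hN⟩ := gram_pos hg (linearIndependent_body σ)
  have h02 : σ 2 ≠ σ 0 := σ.injective.ne (by decide)
  have h12 : σ 2 ≠ σ 1 := σ.injective.ne (by decide)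
  have h10 : σ 0 ≠ σ 1 := σ.injective.ne (by decide)
  -- Of the three edge vectors only the body-diagonal has a component in direction `σ 2`. Its
  -- squared length gains `2 * t`, its products with the other two gain `t`, and the remaining
  -- products are unchanged.
  have v3 : ∀ i, vec σ 0 3 i = 1 := fun i => by simp [vec_eq_intCast, vecInt_zero_three]
  have v10 : vec σ 0 1 (σ 0) = 1 := by simp [vec_eq_intCast, vecInt_zero_one]
  have v12 : vec σ 0 1 (σ 2) = 0 := by simp [vec_eq_intCast, vecInt_zero_one, h02]
  have v20 : vec σ 0 2 (σ 0) = 1 := by simp [vec_eq_intCast, vecInt_zero_two, h10]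
  have v22 : vec σ 0 2 (σ 2) = 0 := by simp [vec_eq_intCast, vecInt_zero_two, h02, h12]
  unfold dihedral
  simp only [ip_stretch, v3, v10, v12, v20, v22]
  unfold bodyRate
  generalize ip g (vec σ 0 3) (vec σ 0 3) = a at *
  generalize ip g (vec σ 0 1) (vec σ 0 1) = b at *
  generalize ip g (vec σ 0 2) (vec σ 0 2) = c at *
  generalize ip g (vec σ 0 3) (vec σ 0 1) = d at *
  generalize ip g (vec σ 0 3) (vec σ 0 2) = e at *
  generalize ip g (vec σ 0 1) (vec σ 0 2) = f at *
  have hlin : ∀ r s : ℝ, HasDerivAt (fun t : ℝ => r + t * s) s 0 := fun r s => by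
    simpa using ((hasDerivAt_id (0 : ℝ)).mul_const s).const_add r
  have := hasDerivAt_arccos_div
    (((hlin a (1 * 1 + 1 * 1)).mul (hlin f (1 * 0 + 0 * 1))).sub
      ((hlin d (1 * 0 + 1 * 1)).mul (hlin e (1 * 0 + 1 * 1))))
    (((hlin a (1 * 1 + 1 * 1)).mul (hlin b (1 * 0 + 0 * 1))).sub
      ((hlin d (1 * 0 + 1 * 1)).pow 2))
    (((hlin a (1 * 1 + 1 * 1)).mul (hlin c (1 * 0 + 0 * 1))).sub
      ((hlin e (1 * 0 + 1 * 1)).pow 2))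
    (by simpa using hX) (by simpa using hY) (by simpa using hN)
  refine this.congr_deriv ?_
  simp
  ring_nf

/-- The rate `bodyRate` in terms of coordinate directions. -/
def coordRate (g : Matrix (Fin 3) (Fin 3) ℝ) (i j : Fin 3) : ℝ :=
  bodyRate g 1 (Pi.single i 1) (Pi.single i 1 + Pi.single j 1)

/-- The numerator of `bodyRate`, split according to the projections `d` of the coordinate vectors
to the body-diagonal.  The square root in `bodyRate` is the same for all six tetrahedra. -/
theorem bodyRate_eq {g : Matrix (Fin 3) (Fin 3) ℝ} (hg : g.IsHermitian) {i j k : Fin 3}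
    (hs : ∀ f : Fin 3 → ℝ, ∑ l, f l = f i + f j + f k) {a : ℝ} (ha : a = ip g 1 1) {d : Fin 3 → ℝ}
    (hd : ∀ l, d l = ip g 1 (Pi.single l 1)) :
    coordRate g i j =
      -(2 * (d i - g i k) - (d i + (a - d k))
        + (a * g i k - d i * d k) * ((g i i - d i) / (a * g i i - d i ^ 2)
          + (g k k - d k) / (a * g k k - d k ^ 2))) /
      Real.sqrt (a * (g i i * g j j * g k k + 2 * g i j * g i k * g j k - g i i * g j k ^ 2
        - g j j * g i k ^ 2 - g k k * g i j ^ 2)) := by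
  have hsym : ∀ p q, g p q = g q p := fun p q => by simpa using hg.apply q p
  have hd' : ∀ l, d l = g i l + g j l + g k l := fun l => by
    rw [hd, ← hs fun m => g m l]
    simp [ip, dotProduct]
  have ha' : a = d i + d j + d k := by
    rw [ha, ← hs d]
    simp only [hd, ip, dotProduct, Matrix.mulVec, Pi.one_apply, one_mul, mul_one, Pi.single_apply,
      mul_ite, mul_zero, Finset.sum_ite_eq', Finset.mem_univ, if_true]
    exact Finset.sum_comm
  -- The vector `e_i + e_j` is the body-diagonal minus `e_k`, so its projection along the
  -- body-diagonal is minus that of `e_k`. Everything can be written in terms of `i` and `k`.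
  have hc : ip g (Pi.single i 1 + Pi.single j 1) (Pi.single i 1 + Pi.single j 1) =
      a - 2 * d k + g k k := by
    simp only [ip_add_left, ip_add_right, ip_single]
    rw [ha', hd' i, hd' j, hd' k, hsym j i, hsym k i, hsym k j]
    ring
  have hf : ip g (Pi.single i 1) (Pi.single i 1 + Pi.single j 1) = d i - g i k := by
    rw [ip_add_right, ip_single, ip_single, hd' i, hsym j i, hsym k i]
    ring
  have he : ip g 1 (Pi.single i 1 + Pi.single j 1) = a - d k := by
    rw [ip_add_right, ← hd, ← hd, ha']
    ring
  unfold coordRate bodyRate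
  rw [hc, hf, he, ip_single, ← hd, ← ha]
  have h1 : a * (d i - g i k) - d i * (a - d k) = -(a * g i k - d i * d k) := by ring
  have h2 : a * (a - 2 * d k + g k k) - (a - d k) ^ 2 = a * g k k - d k ^ 2 := by ring
  have h3 : 2 * (a - 2 * d k + g k k) - 2 * (a - d k) = 2 * (g k k - d k) := by ring
  -- The radicand is `a` times the determinant of `g`, which does not depend on the order of `i, j,
  -- k`.
  have h4 : (a * g i i - d i ^ 2) * (a * g k k - d k ^ 2) - (-(a * g i k - d i * d k)) ^ 2 =
      a * (g i i * g j j * g k k + 2 * g i j * g i k * g j k - g i i * g j k ^ 2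
        - g j j * g i k ^ 2 - g k k * g i j ^ 2) := by
    rw [ha', hd' i, hd' j, hd' k, hsym j i, hsym k i, hsym k j]
    ring
  rw [h1, h2, h3, h4, ← mul_sub 2 (g i i) (d i), mul_left_comm _ (2 : ℝ), mul_left_comm _ (2 : ℝ),
    mul_div_mul_left _ _ (two_ne_zero' ℝ), mul_div_mul_left _ _ (two_ne_zero' ℝ)]
  ring

/-- Stretching the body-diagonal of a flat block changes its deficit angle to first order. -/
theorem sum_bodyRate_ne_zero {g : Matrix (Fin 3) (Fin 3) ℝ} (hg : g.PosDef) :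
    ∑ σ : Equiv.Perm (Fin 3), bodyRate g (vec σ 0 3) (vec σ 0 1) (vec σ 0 2) ≠ 0 := by
  have hv : ∀ σ : Equiv.Perm (Fin 3), vec σ 0 3 = 1 ∧ vec σ 0 1 = Pi.single (σ 0) 1 ∧
      vec σ 0 2 = Pi.single (σ 0) 1 + Pi.single (σ 1) 1 := fun σ => by
    refine ⟨?_, ?_, ?_⟩ <;> ext i <;>
      simp [vec_eq_intCast, vecInt_zero_three, vecInt_zero_one, vecInt_zero_two, Pi.single_apply]
  have hX : ∀ σ : Equiv.Perm (Fin 3),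
      0 < ip g 1 1 * g (σ 0) (σ 0) - ip g 1 (Pi.single (σ 0) 1) ^ 2 := fun σ => by
    have := (gram_pos hg (linearIndependent_body σ)).2.1
    rwa [(hv σ).1, (hv σ).2.1, ip_single] at this
  have hsum : ∑ σ : Equiv.Perm (Fin 3), bodyRate g (vec σ 0 3) (vec σ 0 1) (vec σ 0 2) =
      ∑ σ : Equiv.Perm (Fin 3), coordRate g (σ 0) (σ 1) :=
    Finset.sum_congr rfl fun σ _ => by rw [(hv σ).1, (hv σ).2.1, (hv σ).2.2, coordRate]
  rw [hsum, sum_perm_fin_three fun i j _ => coordRate g i j]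
  have hsym : ∀ p q, g p q = g q p := fun p q => by simpa using hg.1.apply q p
  obtain ⟨a, ha⟩ : ∃ a, a = ip g 1 1 := ⟨_, rfl⟩
  obtain ⟨d, hd⟩ : ∃ d : Fin 3 → ℝ, ∀ l, d l = ip g 1 (Pi.single l 1) := ⟨_, fun _ => rfl⟩
  have hs : ∀ f : Fin 3 → ℝ, ∑ l, f l = f 0 + f 1 + f 2 := Fin.sum_univ_three
  have hdl : ∀ l, d l = g 0 l + g 1 l + g 2 l := fun l => by
    rw [hd, ← hs fun m => g m l]
    simp [ip, dotProduct]
  have ha' : a = d 0 + d 1 + d 2 := by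
    rw [ha, ← hs d]
    simp only [hd, ip, dotProduct, Matrix.mulVec, Pi.one_apply, one_mul, mul_one, Pi.single_apply,
      mul_ite, mul_zero, Finset.sum_ite_eq', Finset.mem_univ, if_true]
    exact Finset.sum_comm
  -- Three permutations with first values `0`, `1`, `2`.
  have hX0 := hX 1
  have hX1 := hX (Equiv.swap 0 1)
  have hX2 := hX (Equiv.swap 0 2)
  have ha0 : 0 < a := ha ▸ ip_pos hg one_ne_zero
  simp only [Equiv.Perm.one_apply, Equiv.swap_apply_left, ← hd, ← ha] at hX0 hX1 hX2
  have hdet : 0 < a * (g 0 0 * g 1 1 * g 2 2 + 2 * g 0 1 * g 0 2 * g 1 2 - g 0 0 * g 1 2 ^ 2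
      - g 1 1 * g 0 2 ^ 2 - g 2 2 * g 0 1 ^ 2) := by
    have := mul_pos ha0 hg.det_pos
    rw [Matrix.det_fin_three, hsym 1 0, hsym 2 0, hsym 2 1] at this
    linarith
  rw [bodyRate_eq hg.1 (i := 0) (j := 1) (k := 2) (fun f => by rw [hs]) ha hd,
    bodyRate_eq hg.1 (i := 0) (j := 2) (k := 1) (fun f => by rw [hs]; ring) ha hd,
    bodyRate_eq hg.1 (i := 1) (j := 0) (k := 2) (fun f => by rw [hs]; ring) ha hd,
    bodyRate_eq hg.1 (i := 1) (j := 2) (k := 0) (fun f => by rw [hs]; ring) ha hd,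
    bodyRate_eq hg.1 (i := 2) (j := 0) (k := 1) (fun f => by rw [hs]; ring) ha hd,
    bodyRate_eq hg.1 (i := 2) (j := 1) (k := 0) (fun f => by rw [hs]; ring) ha hd]
  rw [hsym 1 0, hsym 2 0, hsym 2 1]
  obtain ⟨D, hD⟩ : ∃ D, D = a * (g 0 0 * g 1 1 * g 2 2 + 2 * g 0 1 * g 0 2 * g 1 2
    - g 0 0 * g 1 2 ^ 2 - g 1 1 * g 0 2 ^ 2 - g 2 2 * g 0 1 ^ 2) := ⟨_, rfl⟩
  have e1 : a * (g 0 0 * g 2 2 * g 1 1 + 2 * g 0 2 * g 0 1 * g 1 2 - g 0 0 * g 1 2 ^ 2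
    - g 2 2 * g 0 1 ^ 2 - g 1 1 * g 0 2 ^ 2) = D := by rw [hD]; ring
  have e2 : a * (g 1 1 * g 0 0 * g 2 2 + 2 * g 0 1 * g 1 2 * g 0 2 - g 1 1 * g 0 2 ^ 2
    - g 0 0 * g 1 2 ^ 2 - g 2 2 * g 0 1 ^ 2) = D := by rw [hD]; ring
  have e3 : a * (g 1 1 * g 2 2 * g 0 0 + 2 * g 1 2 * g 0 1 * g 0 2 - g 1 1 * g 0 2 ^ 2
    - g 2 2 * g 0 1 ^ 2 - g 0 0 * g 1 2 ^ 2) = D := by rw [hD]; ring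
  have e4 : a * (g 2 2 * g 0 0 * g 1 1 + 2 * g 0 2 * g 1 2 * g 0 1 - g 2 2 * g 0 1 ^ 2
    - g 0 0 * g 1 2 ^ 2 - g 1 1 * g 0 2 ^ 2) = D := by rw [hD]; ring
  have e5 : a * (g 2 2 * g 1 1 * g 0 0 + 2 * g 1 2 * g 0 2 * g 0 1 - g 2 2 * g 0 1 ^ 2
    - g 1 1 * g 0 2 ^ 2 - g 0 0 * g 1 2 ^ 2) = D := by rw [hD]; ring
  rw [← hD, e1, e2, e3, e4, e5]
  rw [← hD] at hdet
  have hsD := Real.sqrt_pos.2 hdet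
  -- Only these three fractions occur in the six numerators. Naming them leaves a polynomial
  -- identity modulo their defining equations.
  obtain ⟨h0, hh0⟩ : ∃ h, h = (g 0 0 - d 0) / (a * g 0 0 - d 0 ^ 2) := ⟨_, rfl⟩
  obtain ⟨h1, hh1⟩ : ∃ h, h = (g 1 1 - d 1) / (a * g 1 1 - d 1 ^ 2) := ⟨_, rfl⟩
  obtain ⟨h2, hh2⟩ : ∃ h, h = (g 2 2 - d 2) / (a * g 2 2 - d 2 ^ 2) := ⟨_, rfl⟩
  rw [← hh0, ← hh1, ← hh2]
  rw [eq_div_iff hX0.ne'] at hh0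
  rw [eq_div_iff hX1.ne'] at hh1
  rw [eq_div_iff hX2.ne'] at hh2
  have d0 : d 0 = g 0 0 + g 0 1 + g 0 2 := by rw [hdl, hsym 1 0, hsym 2 0]
  have d1 : d 1 = g 0 1 + g 1 1 + g 1 2 := by rw [hdl, hsym 2 1]
  have d2 : d 2 = g 0 2 + g 1 2 + g 2 2 := hdl 2
  simp only [← add_div]
  refine div_ne_zero (ne_of_gt ?_) hsD.ne'
  -- The six numerators add up to twice the squared length of the body-diagonal.
  refine lt_of_lt_of_eq (b := 2 * a) (by positivity) ?_
  rw [ha', d0, d1, d2] at hh0 hh1 hh2 ⊢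
  linear_combination -2 * hh0 - 2 * hh1 - 2 * hh2

/-! ### Implicitly defined real functions -/

/-- An equation `Φ (δ, β) = 0` in one unknown `β` with non-zero derivative has a continuous solution,
and every continuous solution up to first order is differentiable. -/
theorem implicit_scalar {E : Type*} [NormedAddCommGroup E] [NormedSpace ℝ E] [CompleteSpace E]
    {Φ : E × ℝ → ℝ} {β₀ κ : ℝ} (hΦ : ContDiffAt ℝ 1 Φ (0, β₀)) (h0 : Φ (0, β₀) = 0)
    (hκ : HasDerivAt (fun β => Φ (0, β)) κ β₀) (hne : κ ≠ 0) :
    (∃ b : E → ℝ, b 0 = β₀ ∧ ContinuousAt b 0 ∧ ∀ᶠ δ in 𝓝 0, Φ (δ, b δ) = 0) ∧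
      ∀ b : E → ℝ, b 0 = β₀ → ContinuousAt b 0 →
        (fun δ => Φ (δ, b δ)) =o[𝓝 0] (fun δ => δ) → DifferentiableAt ℝ b 0 := by
  obtain ⟨Φ', hΦ'⟩ : ∃ Φ' : E × ℝ →L[ℝ] ℝ, HasStrictFDerivAt Φ Φ' (0, β₀) :=
    ⟨_, hΦ.hasStrictFDerivAt one_ne_zero⟩
  have hκ' : Φ' (0, 1) = κ := by
    have := hΦ'.hasFDerivAt.comp_hasDerivAt β₀ ((hasDerivAt_const β₀ (0 : E)).prodMk
      (hasDerivAt_id β₀))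
    exact this.unique hκ
  have hsplit : ∀ x : E × ℝ, Φ' x = Φ' (x.1, 0) + κ * x.2 := fun x => by
    have : x = (x.1, (0 : ℝ)) + x.2 • ((0 : E), (1 : ℝ)) := by ext <;> simp
    conv_lhs => rw [this]
    rw [map_add, map_smul, hκ', smul_eq_mul, mul_comm]
  -- The derivative of `(δ, β) ↦ (δ, Φ (δ, β))`. It is triangular with diagonal entry `κ`, hence
  -- invertible, and the inverse function theorem applies.
  let e : (E × ℝ) ≃L[ℝ] E × ℝ := ContinuousLinearEquiv.equivOfInverse
    ((ContinuousLinearMap.fst ℝ E ℝ).prod Φ')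
    ((ContinuousLinearMap.fst ℝ E ℝ).prod (κ⁻¹ • (ContinuousLinearMap.snd ℝ E ℝ
      - Φ'.comp ((ContinuousLinearMap.inl ℝ E ℝ).comp (ContinuousLinearMap.fst ℝ E ℝ)))))
    (fun x => by
      ext
      · rfl
      · change κ⁻¹ * (Φ' x - Φ' (x.1, 0)) = x.2
        rw [hsplit x, add_sub_cancel_left, inv_mul_cancel_left₀ hne])
    (fun x => by
      ext
      · rfl
      · change Φ' (x.1, κ⁻¹ * (x.2 - Φ' (x.1, 0))) = x.2
        rw [hsplit, mul_inv_cancel_left₀ hne, add_sub_cancel])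
  have hs : HasStrictFDerivAt (fun x : E × ℝ => (x.1, Φ x)) (e : E × ℝ →L[ℝ] E × ℝ) (0, β₀) :=
    hasStrictFDerivAt_fst.prodMk hΦ'
  have hg0 := hs.localInverse_apply_image
  have hgc := hs.localInverse_continuousAt
  have hgd := hs.to_localInverse.hasFDerivAt
  have hr := hs.eventually_right_inverse
  simp only [h0] at hg0 hgc hgd hr
  constructor
  · have hc : ContinuousAt (fun δ : E => (δ, (0 : ℝ))) 0 := by fun_prop
    refine ⟨fun δ => (hs.localInverse _ _ _ (δ, 0)).2, by simp only [hg0], ?_, ?_⟩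
    · exact continuousAt_snd.comp
        (ContinuousAt.comp (g := hs.localInverse _ _ _) (f := fun δ : E => (δ, (0 : ℝ))) hgc hc)
    · filter_upwards [hc.tendsto.eventually hr] with δ hδ
      have h1 := (Prod.ext_iff.1 hδ).1
      have h2 := (Prod.ext_iff.1 hδ).2
      dsimp only at h1 h2
      refine Eq.trans (congrArg Φ (Prod.ext ?_ ?_)) h2
      · exact h1.symm
      · rfl
  · intro b hb hbc ho
    have hc : Tendsto (fun δ : E => (δ, b δ)) (𝓝 0) (𝓝 (0, β₀)) := by
      have := continuousAt_id.prodMk hbc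
      simpa [ContinuousAt, hb] using this
    have hl := hc.eventually hs.eventually_left_inverse
    -- The first-order constraint says that this derivative is zero. So `δ ↦ (δ, Φ (δ, b δ))` is
    -- differentiable at `0`, and the local inverse turns it back into `(δ, b δ)`; continuity of `b`
    -- keeps the points where the inverse is valid.
    have hd : HasFDerivAt (fun δ => Φ (δ, b δ)) (0 : E →L[ℝ] ℝ) 0 := by
      refine HasFDerivAt.of_isLittleO ?_
      simpa [hb, h0] using ho
    have hd' : HasFDerivAt (fun δ : E => (δ, Φ (δ, b δ)))
        ((ContinuousLinearMap.id ℝ E).prod (0 : E →L[ℝ] ℝ)) 0 := (hasFDerivAt_id _).prodMk hd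
    have hgd' : DifferentiableAt ℝ (hs.localInverse _ _ _) ((0 : E), Φ (0, b 0)) := by
      rw [hb, h0]; exact hgd.differentiableAt
    have := (DifferentiableAt.comp (0 : E) (f := fun δ : E => (δ, Φ (δ, b δ))) hgd'
      hd'.differentiableAt).snd
    refine this.congr_of_eventuallyEq ?_
    filter_upwards [hl] with δ hδ
    simp only [Function.comp, hδ]

/-! ### Deficit angles at the body-diagonals -/

/-- The six tetrahedra around a body-diagonal contain no other body-diagonal. The constraints
therefore decouple into one scalar equation per block. -/
theorem deficit_bodyDiag_congr {n : Fin 3 → ℕ} (k : BlockType) (c : ℝ) (δ : FaceDiag n → ℝ)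
    {b b' : Vertex n → ℝ} {v : Vertex n} (h : b v = b' v) :
    deficit (lengths k c δ b) (bodyDiag v) = deficit (lengths k c δ b') (bodyDiag v) := by
  have hL : ∀ (σ : Equiv.Perm (Fin 3)) (a a' : Fin 4) (hn : (reach σ a' \ reach σ a).Nonempty),
      lengths k c δ b (v + offset n (reach σ a), ⟨reach σ a' \ reach σ a, hn⟩) =
        lengths k c δ b' (v + offset n (reach σ a), ⟨reach σ a' \ reach σ a, hn⟩) := by
    intro σ a a' hn
    unfold lengths
    split_ifs with h1 h2
    · rfl
    · obtain ⟨rfl, -⟩ := (reach_diff_eq_univ σ a a').1 h2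
      simpa [reach_zero, offset_empty] using h
    · rfl
  have hside : ∀ (σ : Equiv.Perm (Fin 3)) (a a' : Fin 4),
      side (lengths k c δ b) (v, σ) a a' = side (lengths k c δ b') (v, σ) a a' := by
    intro σ a a'
    unfold side
    split_ifs
    · exact hL σ a a' _
    · exact hL σ a' a _
    · rfl
  simp only [deficit_bodyDiag, metric, hside]

theorem hasDerivAt_deficit_bodyDiag {n : Fin 3 → ℕ} (k : BlockType) {c : ℝ} (hc : 0 < c)
    (v : Vertex n) : ∃ κ ≠ 0, HasDerivAt (fun β => deficit (lengths k c 0 fun _ => β) (bodyDiag v))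
      κ (flatLength k c (bodyDiag v).2) := by
  have hg := posDef_flatMetric k hc
  have hpos : 0 < flatLength k c (bodyDiag v).2 := by
    rw [flatLength_eq k hc]; exact latticeLength_pos hg _
  refine ⟨-∑ σ : Equiv.Perm (Fin 3), bodyRate (flatMetric k c) (vec σ 0 3) (vec σ 0 1) (vec σ 0 2) *
    flatLength k c (bodyDiag v).2, ?_, ?_⟩
  · rw [← Finset.sum_mul]
    exact neg_ne_zero.2 (mul_ne_zero (sum_bodyRate_ne_zero hg) hpos.ne')
  · simp only [deficit_bodyDiag, metric_lengths_zero k hc]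
    refine HasDerivAt.const_sub _ (HasDerivAt.fun_sum fun σ _ => ?_)
    -- The parameter of `stretch` is half the change of the squared length.
    have h1 : HasDerivAt (fun β : ℝ => (β ^ 2 - flatLength k c (bodyDiag v).2 ^ 2) / 2)
        (flatLength k c (bodyDiag v).2) (flatLength k c (bodyDiag v).2) := by
      have := ((hasDerivAt_pow 2 (flatLength k c (bodyDiag v).2)).sub_const
        (flatLength k c (bodyDiag v).2 ^ 2)).div_const 2
      exact this.congr_deriv (by simp)
    have h2 := hasDerivAt_dihedral_stretch hg σ
    have h3 := HasDerivAt.comp_of_eq (flatLength k c (bodyDiag v).2) h2 h1 (by simp)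
    exact h3

section rules

variable {n : Fin 3 → ℕ} [∀ i, NeZero (n i)] (k : BlockType) {c : ℝ}

omit [∀ i, NeZero (n i)] in
theorem lengths_const_zero (hc : 0 < c) (v : Vertex n) :
    lengths (n := n) k c 0 (fun _ => flatLength k c (bodyDiag v).2) =
      fun e => latticeLength (flatMetric k c) e.2 :=
  lengths_zero k hc fun _ => rfl

theorem contDiffAt_deficit_flat (hc : 0 < c) (e : Edge n) :
    ContDiffAt ℝ 1 (fun L : Edge n → ℝ => deficit L e)
      (fun e => latticeLength (flatMetric k c) e.2) :=
  contDiffAt_deficit (fun T => by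
    rw [metric_latticeLength (posDef_flatMetric k hc)]; exact posDef_flatMetric k hc) e

theorem contDiffAt_deficit_lengths (hc : 0 < c) (v : Vertex n) :
    ContDiffAt ℝ 1 (fun x : (FaceDiag n → ℝ) × ℝ =>
      deficit (lengths k c x.1 fun _ => x.2) (bodyDiag v)) (0, flatLength k c (bodyDiag v).2) := by
  have h1 : ContDiff ℝ 1 fun x : (FaceDiag n → ℝ) × ℝ => lengths k c x.1 fun _ => x.2 := by
    refine contDiff_pi.2 fun e => ?_
    unfold lengths
    split_ifs
    · exact contDiff_const.add ((contDiff_apply ℝ ℝ _).comp contDiff_fst)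
    · exact contDiff_snd
    · exact contDiff_const
  refine ContDiffAt.comp (f := fun x : (FaceDiag n → ℝ) × ℝ => lengths k c x.1 fun _ => x.2)
    (g := fun L : Edge n → ℝ => deficit L (bodyDiag v)) _ ?_ h1.contDiffAt
  dsimp only
  rw [lengths_const_zero k hc v]
  exact contDiffAt_deficit_flat k hc _

omit [∀ i, NeZero (n i)] in
theorem deficit_flat (hc : 0 < c) (v : Vertex n) : deficit (lengths k c (0 : FaceDiag n → ℝ)
    fun _ => flatLength k c (bodyDiag v).2) (bodyDiag v) = 0 := by
  rw [lengths_const_zero k hc v]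
  exact deficit_latticeLength (posDef_flatMetric k hc) _

theorem exists_isFlatBlockRule (hc : 0 < c) :
    ∃ b : (FaceDiag n → ℝ) → Vertex n → ℝ, IsFlatBlockRule k c b := by
  have h : ∀ v : Vertex n, ∃ b : (FaceDiag n → ℝ) → ℝ, b 0 = flatLength k c (bodyDiag v).2 ∧
      ContinuousAt b 0 ∧ ∀ᶠ δ in 𝓝 0, deficit (lengths k c δ fun _ => b δ) (bodyDiag v) = 0 :=
    fun v => by
      obtain ⟨κ, hne, hκ⟩ := hasDerivAt_deficit_bodyDiag k hc v
      exact (implicit_scalar (contDiffAt_deficit_lengths k hc v) (deficit_flat k hc v) hκ hne).1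
  choose b h1 h2 h3 using h
  refine ⟨fun δ v => b v δ, h1, continuousAt_pi.2 h2, ?_⟩
  filter_upwards [eventually_all.2 h3] with δ hδ v
  rw [← hδ v]
  exact deficit_bodyDiag_congr k c δ rfl

theorem IsLinearFlatBlockRule.differentiableAt {b : (FaceDiag n → ℝ) → Vertex n → ℝ}
    (h : IsLinearFlatBlockRule k c b) (hc : 0 < c) : DifferentiableAt ℝ b 0 := by
  refine differentiableAt_pi.2 fun v => ?_
  obtain ⟨κ, hne, hκ⟩ := hasDerivAt_deficit_bodyDiag k hc v
  refine (implicit_scalar (contDiffAt_deficit_lengths k hc v) (deficit_flat k hc v) hκ hne).2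
    (fun δ => b δ v) (h.1 v) (continuousAt_pi.1 h.2.1 v) ?_
  refine (h.2.2 v).congr_left fun δ => ?_
  exact deficit_bodyDiag_congr k c δ rfl

end rules

/-! ### Volumes -/

theorem isCompact_cell (σ : Equiv.Perm (Fin 3)) (a : Fin 4) : IsCompact (cell σ a) := by
  have h : cell σ a = (fun t : Fin 4 → ℝ => ∑ b, t b • vec σ a b) ''
      (stdSimplex ℝ (Fin 4) ∩ {t | ∀ b, t b ≤ t a}) := by
    ext x
    simp only [cell, Set.mem_ofPred_eq, Set.mem_image, Set.mem_inter_iff]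
    constructor
    · rintro ⟨t, h1, h2, h3⟩
      exact ⟨t, ⟨h1, h2⟩, h3.symm⟩
    · rintro ⟨t, ⟨h1, h2⟩, h3⟩
      exact ⟨t, h1, h2, h3.symm⟩
  rw [h]
  refine IsCompact.image ((isCompact_stdSimplex ℝ (Fin 4)).inter_right ?_) (by fun_prop)
  simp only [Set.ofPred_forall]
  exact isClosed_iInter fun b => isClosed_le (by fun_prop) (by fun_prop)

theorem volume_cell_ne_top (σ : Equiv.Perm (Fin 3)) (a : Fin 4) : volume (cell σ a) ≠ ⊤ :=
  (isCompact_cell σ a).measure_lt_top.ne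

theorem volume_cell_one_pos : 0 < volume.real (cell 1 0) := by
  -- On this box `1 > x 0 > x 1 > x 2 > 0`, and the barycentric coordinate `1 - x 0` of vertex `0`
  -- exceeds the other three.
  have hsub : Set.pi Set.univ (fun i : Fin 3 =>
      Set.Ioo ((![1 / 4, 3 / 20, 1 / 20] : Fin 3 → ℝ) i) ((![3 / 10, 1 / 5, 1 / 10] : Fin 3 → ℝ) i))
      ⊆ cell 1 0 := by
    intro x hx
    have h0 := hx 0 trivial
    have h1 := hx 1 trivial
    have h2 := hx 2 trivial
    simp at h0 h1 h2
    refine ⟨![1 - x 0, x 0 - x 1, x 1 - x 2, x 2], ⟨fun b => ?_, ?_⟩, fun b => ?_, ?_⟩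
    · fin_cases b <;> simp <;> linarith
    · simp [Fin.sum_univ_four]
    · fin_cases b <;> simp <;> linarith
    · have hr : ∀ (b : Fin 4) (i : Fin 3), (i ∈ reach 1 b ↔ i.castSucc < b) := by decide +kernel
      ext i
      fin_cases i <;>
        simp [Fin.sum_univ_four, vec, coord, hr]
  refine ENNReal.toReal_pos (ne_of_gt ?_) (volume_cell_ne_top 1 0)
  refine lt_of_lt_of_le ?_ (measure_mono hsub)
  refine (isOpen_set_pi Set.finite_univ fun _ _ => isOpen_Ioo).measure_pos volume ?_
  refine Set.univ_pi_nonempty_iff.2 fun i => Set.nonempty_Ioo.2 ?_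
  fin_cases i <;> norm_num

/-- The plane orthogonal to `d` is a proper subspace, as it misses `d`, and so is null. Only there
can membership in a capped cell jump when the metric varies. -/
theorem ae_ip_ne_zero {g : Matrix (Fin 3) (Fin 3) ℝ} (hg : g.PosDef) {d : Fin 3 → ℝ} (hd : d ≠ 0) :
    ∀ᵐ x : Fin 3 → ℝ, ip g x d ≠ 0 := by
  let f : (Fin 3 → ℝ) →ₗ[ℝ] ℝ :=
    { toFun := fun x => ip g x d
      map_add' := fun x y => ip_add_left g x y d
      map_smul' := fun r x => ip_smul_left g x d r }
  have hne : LinearMap.ker f ≠ ⊤ := fun h => by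
    have : d ∈ LinearMap.ker f := h ▸ Submodule.mem_top
    exact (ip_pos hg hd).ne' this
  have := Measure.addHaar_submodule volume _ hne
  rw [ae_iff]
  refine Eq.trans (congrArg _ ?_) this
  ext x
  simp [f]

theorem tendsto_ip {α : Type*} {l : Filter α} {M : α → Matrix (Fin 3) (Fin 3) ℝ}
    {g : Matrix (Fin 3) (Fin 3) ℝ} (hM : ∀ i j, Tendsto (fun y => M y i j) l (𝓝 (g i j)))
    (u w : Fin 3 → ℝ) : Tendsto (fun y => ip (M y) u w) l (𝓝 (ip g u w)) := by
  simp only [ip_eq_sum]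
  exact tendsto_finsetSum _ fun i _ => tendsto_finsetSum _ fun j _ =>
    ((hM i j).const_mul _).mul_const _

/-- The volume of the part of a dual cell on one side of a plane depends continuously on the
metric. -/
theorem tendsto_volume_cap {α : Type*} {l : Filter α} [l.IsCountablyGenerated]
    {M : α → Matrix (Fin 3) (Fin 3) ℝ} {g : Matrix (Fin 3) (Fin 3) ℝ}
    (hM : ∀ i j, Tendsto (fun y => M y i j) l (𝓝 (g i j))) (hg : g.PosDef) {d : Fin 3 → ℝ}
    (hd : d ≠ 0) (σ : Equiv.Perm (Fin 3)) (a : Fin 4) :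
    Tendsto (fun y => volume.real {x | x ∈ cell σ a ∧ 0 ≤ ip (M y) x d}) l
      (𝓝 (volume.real {x | x ∈ cell σ a ∧ 0 ≤ ip g x d})) := by
  have hmeas : ∀ m : Matrix (Fin 3) (Fin 3) ℝ, MeasurableSet {x | x ∈ cell σ a ∧ 0 ≤ ip m x d} :=
    fun m => by
      have hc : Continuous fun x => ip m x d := by unfold ip; fun_prop
      exact (isCompact_cell σ a).measurableSet.inter (isClosed_le continuous_const hc).measurableSet
  have hfin : ∀ m : Matrix (Fin 3) (Fin 3) ℝ, volume {x | x ∈ cell σ a ∧ 0 ≤ ip m x d} ≠ ⊤ :=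
    fun m => measure_ne_top_of_subset (fun x hx => hx.1) (volume_cell_ne_top σ a)
  refine (ENNReal.tendsto_toReal (hfin g)).comp ?_
  refine tendsto_measure_of_ae_tendsto_indicator l (hmeas g) (fun y => hmeas (M y))
    (isCompact_cell σ a).measurableSet (volume_cell_ne_top σ a)
    (Eventually.of_forall fun y x hx => hx.1) ?_
  -- Off the plane the sign of `ip g x d` survives small changes of the metric, so the indicators
  -- are eventually constant.
  filter_upwards [ae_ip_ne_zero hg hd] with x hx
  have ht := tendsto_ip hM x d
  rcases lt_or_gt_of_ne hx with h | h
  · filter_upwards [ht.eventually_lt_const h] with y hy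
    simp [h.not_ge, hy.not_ge]
  · filter_upwards [ht.eventually_const_lt h] with y hy
    simp [h.le, hy.le]

section volumes

variable {n : Fin 3 → ℕ} [∀ i, NeZero (n i)] {X : Type*} [TopologicalSpace X]
  [FirstCountableTopology X] {Λ : X → Edge n → ℝ} {x₀ : X} {g : Matrix (Fin 3) (Fin 3) ℝ}

omit [FirstCountableTopology X] in
theorem continuousAt_metric (hΛ : ContinuousAt Λ x₀) (T : Tet n) (i j : Fin 3) :
    ContinuousAt (fun x => metric (Λ x) T i j) x₀ :=
  ((contDiff_metric T i j).continuous.continuousAt).comp hΛ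

omit [FirstCountableTopology X] in
theorem continuousAt_sqrt_det (hΛ : ContinuousAt Λ x₀) (T : Tet n) :
    ContinuousAt (fun x => Real.sqrt (metric (Λ x) T).det) x₀ := by
  have := continuousAt_metric hΛ T
  simp only [Matrix.det_fin_three]
  exact ContinuousAt.sqrt (by fun_prop)

omit [FirstCountableTopology X] in
theorem continuousAt_vertexVolume (hΛ : ContinuousAt Λ x₀) (v : Vertex n) :
    ContinuousAt (fun x => vertexVolume (Λ x) v) x₀ :=
  tendsto_finsetSum _ fun _ _ => tendsto_finsetSum _ fun _ _ =>
    (continuousAt_sqrt_det hΛ _).tendsto.mul_const _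

theorem continuousAt_cappedVolume (hΛ : ContinuousAt Λ x₀) (hg : g.PosDef)
    (h0 : Λ x₀ = fun e => latticeLength g e.2) (v : Vertex n) {d : Fin 3 → ℝ} (hd : d ≠ 0) :
    ContinuousAt (fun x => cappedVolume (Λ x) v d) x₀ := by
  refine tendsto_finsetSum _ fun σ _ => tendsto_finsetSum _ fun a _ =>
    (continuousAt_sqrt_det hΛ _).tendsto.mul ?_
  refine tendsto_volume_cap (fun i j => (continuousAt_metric hΛ _ i j).tendsto) ?_ hd σ a
  rw [h0, metric_latticeLength hg]
  exact hg

theorem continuousAt_edgeVolume (hΛ : ContinuousAt Λ x₀) (hg : g.PosDef)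
    (h0 : Λ x₀ = fun e => latticeLength g e.2) (e : Edge n) :
    ContinuousAt (fun x => edgeVolume (Λ x) e) x₀ :=
  (continuousAt_cappedVolume hΛ hg h0 _ (coord_ne_zero e.2)).add
    (continuousAt_cappedVolume hΛ hg h0 _ (neg_ne_zero.2 (coord_ne_zero e.2)))

end volumes

theorem vertexVolume_pos {n : Fin 3 → ℕ} {g : Matrix (Fin 3) (Fin 3) ℝ} (hg : g.PosDef)
    (v : Vertex n) : 0 < vertexVolume (fun e : Edge n => latticeLength g e.2) v := by
  simp only [vertexVolume, metric_latticeLength hg]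
  have hd := Real.sqrt_pos.2 hg.det_pos
  refine Finset.sum_pos' (fun σ _ => Finset.sum_nonneg fun a _ => by positivity)
    ⟨1, Finset.mem_univ _, Finset.sum_pos' (fun a _ => by positivity)
      ⟨0, Finset.mem_univ _, mul_pos hd volume_cell_one_pos⟩⟩

/-- With a constant metric the cells at the two ends are translates of each other, and the two
half-spaces cover everything. Together the caps have at least the volume of one dual cell. -/
theorem edgeVolume_pos {n : Fin 3 → ℕ} {g : Matrix (Fin 3) (Fin 3) ℝ} (hg : g.PosDef)
    (e : Edge n) : 0 < edgeVolume (fun e : Edge n => latticeLength g e.2) e := by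
  refine (vertexVolume_pos hg e.1).trans_le ?_
  simp only [vertexVolume, edgeVolume, cappedVolume, metric_latticeLength hg,
    ← Finset.sum_add_distrib, ← mul_add]
  refine Finset.sum_le_sum fun σ _ => Finset.sum_le_sum fun a _ =>
    mul_le_mul_of_nonneg_left ?_ (Real.sqrt_nonneg _)
  have hfin : ∀ d : Fin 3 → ℝ, volume {x | x ∈ cell σ a ∧ 0 ≤ ip g x d} ≠ ⊤ :=
    fun d => measure_ne_top_of_subset (fun x hx => hx.1) (volume_cell_ne_top σ a)
  refine le_trans (measureReal_mono ?_ ?_) (measureReal_union_le _ _)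
  · intro x hx
    rcases le_total 0 (ip g x (coord e.2.1)) with h | h
    · exact Or.inl ⟨hx, h⟩
    · exact Or.inr ⟨hx, by rw [ip_neg_right]; linarith⟩
  · exact (measure_union_lt_top (hfin _).lt_top (hfin _).lt_top).ne

/-! ### Paths of flat metrics -/

/-- Positivity on the compact unit sphere persists for small `s`, and homogeneity extends it to all
non-zero vectors. -/
theorem eventually_posDef {g h : Matrix (Fin 3) (Fin 3) ℝ} (hg : g.PosDef) (hh : h.IsHermitian) :
    ∀ᶠ s in 𝓝 (0 : ℝ), (g + s • h).PosDef := by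
  have hip : ∀ (s : ℝ) (x : Fin 3 → ℝ), ip (g + s • h) x x = ip g x x + s * ip h x x := fun s x => by
    simp [ip, Matrix.add_mulVec, Matrix.smul_mulVec]
  have hcont : ∀ m : Matrix (Fin 3) (Fin 3) ℝ, Continuous fun x => ip m x x := fun m => by
    unfold ip; fun_prop
  have hs : ∀ᶠ s in 𝓝 (0 : ℝ), ∀ x ∈ Metric.sphere (0 : Fin 3 → ℝ) 1, 0 < ip (g + s • h) x x := by
    refine (isCompact_sphere (0 : Fin 3 → ℝ) 1).eventually_forall_of_forall_eventually fun x hx => ?_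
    have hc : Continuous fun z : ℝ × (Fin 3 → ℝ) => ip (g + z.1 • h) z.2 z.2 := by
      simp only [hip]
      exact ((hcont g).comp continuous_snd).add (continuous_fst.mul ((hcont h).comp continuous_snd))
    refine hc.continuousAt.eventually_const_lt ?_
    have hx0 : x ≠ 0 := by
      rintro rfl
      simp at hx
    simpa using ip_pos hg hx0
  filter_upwards [hs] with s hs
  refine .of_dotProduct_mulVec_pos ?_ fun x hx => ?_
  · rw [Matrix.IsHermitian, Matrix.conjTranspose_add, Matrix.conjTranspose_smul, hg.1.eq, hh.eq]
    simp
  · have hn := norm_pos_iff.2 hx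
    have := hs (‖x‖⁻¹ • x) (by simp [norm_smul, hn.ne'])
    rw [ip_smul_left, ip_smul_right, ← mul_assoc] at this
    have := pos_of_mul_pos_right this (by positivity)
    simpa [ip] using this

theorem hasDerivAt_latticeLength {g h : Matrix (Fin 3) (Fin 3) ℝ} (hg : g.PosDef) (S : Dir) :
    HasDerivAt (fun s : ℝ => latticeLength (g + s • h) S)
      (ip h (coord S.1) (coord S.1) / (2 * latticeLength g S)) 0 := by
  have hip : ∀ s : ℝ, ip (g + s • h) (coord S.1) (coord S.1) =
      ip g (coord S.1) (coord S.1) + s * ip h (coord S.1) (coord S.1) := fun s => by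
    simp [ip, Matrix.add_mulVec, Matrix.smul_mulVec]
  have h1 : HasDerivAt (fun s : ℝ => ip (g + s • h) (coord S.1) (coord S.1))
      (ip h (coord S.1) (coord S.1)) 0 := by
    simp only [hip]
    simpa using ((hasDerivAt_id (0 : ℝ)).mul_const (ip h (coord S.1) (coord S.1))).const_add
      (ip g (coord S.1) (coord S.1))
  have := h1.sqrt (by simpa using (ip_pos hg (coord_ne_zero S)).ne')
  simpa [latticeLength] using this

/-- The direction of the face-diagonals in the coordinate plane of `i` and `j`. -/
def faceDir (i j : Fin 3) : Dir := ⟨{i, j}, Finset.insert_nonempty _ _⟩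

/-- The change of the metric `g` under which the lengths of the face-diagonals change at the rates
`w` and those of the edges in the coordinate directions do not change. -/
def faceVariation (g : Matrix (Fin 3) (Fin 3) ℝ) (w : Dir → ℝ) : Matrix (Fin 3) (Fin 3) ℝ :=
  Matrix.of fun i j => if i = j then 0 else latticeLength g (faceDir i j) * w (faceDir i j)

theorem isHermitian_faceVariation (g : Matrix (Fin 3) (Fin 3) ℝ) (w : Dir → ℝ) :
    (faceVariation g w).IsHermitian := by
  ext i j
  have : faceDir i j = faceDir j i := Subtype.ext (Finset.pair_comm i j)
  simp [faceVariation, this, eq_comm]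

theorem ip_coord (h : Matrix (Fin 3) (Fin 3) ℝ) (S : Finset (Fin 3)) :
    ip h (coord S) (coord S) = ∑ i ∈ S, ∑ j ∈ S, h i j := by
  simp [ip_eq_sum, coord, Finset.sum_ite_mem]

/-- Differentiating `ℓ² = g i i + 2 g i j + g j j` with fixed diagonal gives `ℓ ℓ' = (g i j)'`,
whence the entries of `faceVariation`. -/
theorem faceVariation_of_card_eq_two {g : Matrix (Fin 3) (Fin 3) ℝ} (hg : g.PosDef) (w : Dir → ℝ)
    {S : Dir} (hS : S.1.card = 2) :
    ip (faceVariation g w) (coord S.1) (coord S.1) / (2 * latticeLength g S) = w S := by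
  obtain ⟨i, j, hij, h⟩ := Finset.card_eq_two.1 hS
  obtain rfl : S = faceDir i j := Subtype.ext h
  have hp := latticeLength_pos hg (faceDir i j)
  have hsymm : faceDir j i = faceDir i j := Subtype.ext (Finset.pair_comm j i)
  rw [ip_coord, h, Finset.sum_pair hij, Finset.sum_pair hij, Finset.sum_pair hij]
  simp only [faceVariation, Matrix.of_apply, if_neg hij, if_neg hij.symm, if_true, hsymm]
  field_simp
  ring

theorem faceVariation_of_card_eq_one (g : Matrix (Fin 3) (Fin 3) ℝ) (w : Dir → ℝ)
    {S : Dir} (hS : S.1.card = 1) :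
    ip (faceVariation g w) (coord S.1) (coord S.1) / (2 * latticeLength g S) = 0 := by
  obtain ⟨i, h⟩ := Finset.card_eq_one.1 hS
  simp [ip_coord, h, faceVariation]

theorem card_eq_one_of_ne (S : Dir) (h2 : S.1.card ≠ 2) (h3 : S.1 ≠ Finset.univ) :
    S.1.card = 1 := by
  revert S; decide

/-! ### The linearized deficit angles -/

section linearization

variable {n : Fin 3 → ℕ} [∀ i, NeZero (n i)] {k : BlockType} {c : ℝ}

omit [∀ i, NeZero (n i)] in
theorem lengths_add_smul (hc : 0 < c) {x : Edge n → ℝ}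
    (hx : ∀ e : Edge n, e.2.1 ≠ Finset.univ → x e = 0) (t : ℝ) :
    lengths k c 0 (fun v => flatLength k c (bodyDiag v).2 + t * x (bodyDiag v)) =
      (fun e => latticeLength (flatMetric k c) e.2) + t • x := by
  ext ⟨v, S, hS⟩
  simp only [lengths, Pi.zero_apply, add_zero, dite_eq_ite, Pi.add_apply, Pi.smul_apply, smul_eq_mul,
    ← flatLength_eq k hc]
  split_ifs with h1 h2
  · rw [hx (v, ⟨S, hS⟩) (by rintro rfl; simp at h1), mul_zero, add_zero]
  · subst h2; rfl
  · rw [hx (v, ⟨S, hS⟩) h2, mul_zero, add_zero]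

/-- A variation of the lengths of the body-diagonals to which the deficit angles at the
body-diagonals do not react to first order is zero. -/
theorem eq_zero_of_fderiv_deficit_eq_zero (hc : 0 < c) {x : Edge n → ℝ}
    (hx : ∀ e : Edge n, e.2.1 ≠ Finset.univ → x e = 0)
    (h : ∀ v, fderiv ℝ (fun L : Edge n → ℝ => deficit L (bodyDiag v))
      (fun e => latticeLength (flatMetric k c) e.2) x = 0) : x = 0 := by
  have hv : ∀ v, x (bodyDiag v) = 0 := fun v => by
    obtain ⟨κ, hne, hκ⟩ := hasDerivAt_deficit_bodyDiag k hc v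
    have hlin : ∀ y : ℝ, HasDerivAt (fun t : ℝ => flatLength k c (bodyDiag v).2 + t * y) y 0 :=
      fun y => by
        simpa using ((hasDerivAt_id (0 : ℝ)).mul_const y).const_add (flatLength k c (bodyDiag v).2)
    have h1 := HasDerivAt.comp_of_eq 0 hκ (hlin (x (bodyDiag v))) (by simp)
    have hline : HasDerivAt (fun t : ℝ => (fun e : Edge n => latticeLength (flatMetric k c) e.2)
        + t • x) x 0 := by
      simpa using ((hasDerivAt_id (0 : ℝ)).smul_const x).const_add
        (fun e : Edge n => latticeLength (flatMetric k c) e.2)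
    have hd := ((contDiffAt_deficit_flat (n := n) k hc (bodyDiag v)).differentiableAt
      one_ne_zero).hasFDerivAt
    have h2 := HasFDerivAt.comp_hasDerivAt_of_eq 0 hd hline (by simp)
    -- By decoupling, block `v` sees only its own body-diagonal along the line, so the derivative is
    -- `κ * x (bodyDiag v)`.
    have h12 : (fun L : Edge n → ℝ => deficit L (bodyDiag v)) ∘ (fun t : ℝ =>
        (fun e : Edge n => latticeLength (flatMetric k c) e.2) + t • x) =
        (fun β => deficit (lengths k c 0 fun _ => β) (bodyDiag v)) ∘
          fun t : ℝ => flatLength k c (bodyDiag v).2 + t * x (bodyDiag v) := by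
      ext t
      simp only [Function.comp, ← lengths_add_smul hc hx]
      exact deficit_bodyDiag_congr k c 0 rfl
    rw [h12] at h2
    have := h1.unique h2
    rw [h v] at this
    exact (mul_eq_zero.1 this).resolve_left hne
  ext ⟨v, S, hS⟩
  by_cases hu : S = Finset.univ
  · subst hu; exact hv v
  · exact hx _ hu

variable {b : (FaceDiag n → ℝ) → Vertex n → ℝ}

theorem IsLinearFlatBlockRule.lengths_zero (h : IsLinearFlatBlockRule k c b) (hc : 0 < c) :
    lengths k c 0 (b 0) = fun e => latticeLength (flatMetric k c) e.2 :=
  FlatBlocks.lengths_zero k hc h.1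

theorem IsLinearFlatBlockRule.differentiableAt_lengths (h : IsLinearFlatBlockRule k c b)
    (hc : 0 < c) : DifferentiableAt ℝ (fun δ => lengths k c δ (b δ)) 0 := by
  refine differentiableAt_pi.2 fun e => ?_
  unfold lengths
  split_ifs
  · exact (differentiableAt_const _).add (differentiableAt_apply _ _)
  · exact differentiableAt_pi.1 (h.differentiableAt k hc) _
  · exact differentiableAt_const _

/-- The deficit angles do not react to first order to a variation through flat metrics. -/
theorem fderiv_deficit_latticeLength {g h : Matrix (Fin 3) (Fin 3) ℝ} (hg : g.PosDef)
    (hh : h.IsHermitian) (e : Edge n) :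
    fderiv ℝ (fun L : Edge n → ℝ => deficit L e) (fun e => latticeLength g e.2)
      (fun e => ip h (coord e.2.1) (coord e.2.1) / (2 * latticeLength g e.2)) = 0 := by
  have hd := ((contDiffAt_deficit (L := fun e : Edge n => latticeLength g e.2) (fun T => by
    rw [metric_latticeLength hg]; exact hg) e).differentiableAt one_ne_zero).hasFDerivAt
  have hcurve : HasDerivAt (fun (s : ℝ) (e : Edge n) => latticeLength (g + s • h) e.2)
      (fun e => ip h (coord e.2.1) (coord e.2.1) / (2 * latticeLength g e.2)) 0 :=
    hasDerivAt_pi.2 fun e => hasDerivAt_latticeLength hg e.2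
  have h1 := HasFDerivAt.comp_hasDerivAt_of_eq 0 hd hcurve (by simp)
  refine h1.unique ((hasDerivAt_const (0 : ℝ) (0 : ℝ)).congr_of_eventuallyEq ?_)
  filter_upwards [eventually_posDef hg hh] with s hs
  exact deficit_latticeLength hs e

theorem IsLinearFlatBlockRule.hasFDerivAt_deficit (h : IsLinearFlatBlockRule k c b) (hc : 0 < c)
    (e : Edge n) : HasFDerivAt (fun δ => deficit (lengths k c δ (b δ)) e)
      ((fderiv ℝ (fun L : Edge n → ℝ => deficit L e)
        (fun e => latticeLength (flatMetric k c) e.2)).comp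
          (fderiv ℝ (fun δ => lengths k c δ (b δ)) 0)) 0 := by
  have hd := ((contDiffAt_deficit_flat (n := n) k hc e).differentiableAt one_ne_zero).hasFDerivAt
  rw [← h.lengths_zero hc] at hd ⊢
  exact HasFDerivAt.comp (g := fun L : Edge n → ℝ => deficit L e)
    (f := fun δ => lengths k c δ (b δ)) 0 hd (h.differentiableAt_lengths hc).hasFDerivAt

theorem IsLinearFlatBlockRule.fderiv_deficit_bodyDiag (h : IsLinearFlatBlockRule k c b)
    (hc : 0 < c) (v : Vertex n) (x : FaceDiag n → ℝ) :
    fderiv ℝ (fun L : Edge n → ℝ => deficit L (bodyDiag v))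
      (fun e => latticeLength (flatMetric k c) e.2)
        (fderiv ℝ (fun δ => lengths k c δ (b δ)) 0 x) = 0 := by
  have h0 : deficit (lengths k c 0 (b 0)) (bodyDiag v) = 0 := by
    rw [h.lengths_zero hc]
    exact deficit_latticeLength (posDef_flatMetric k hc) _
  have hd : HasFDerivAt (fun δ => deficit (lengths k c δ (b δ)) (bodyDiag v))
      (0 : (FaceDiag n → ℝ) →L[ℝ] ℝ) 0 := by
    refine HasFDerivAt.of_isLittleO ?_
    simpa [h0] using h.2.2 v
  have := (h.hasFDerivAt_deficit hc (bodyDiag v)).unique hd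
  exact DFunLike.congr_fun this x

theorem IsLinearFlatBlockRule.fderiv_lengths_apply (h : IsLinearFlatBlockRule k c b) (hc : 0 < c)
    (x : FaceDiag n → ℝ) (e : Edge n) :
    fderiv ℝ (fun δ => lengths k c δ (b δ)) 0 x e =
      fderiv ℝ (fun δ => lengths k c δ (b δ) e) 0 x := by
  have := hasFDerivAt_pi'.1 (h.differentiableAt_lengths hc).hasFDerivAt e
  rw [this.fderiv]
  rfl

/-- If all face-diagonals of a direction change at the same rate, then to first order the blocks
change as the blocks of a flat triangulation. -/
theorem IsLinearFlatBlockRule.fderiv_lengths (h : IsLinearFlatBlockRule k c b) (hc : 0 < c)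
    (w : Dir → ℝ) :
    fderiv ℝ (fun δ => lengths k c δ (b δ)) 0 (fun j => w j.1.2) = fun e =>
      ip (faceVariation (flatMetric k c) w) (coord e.2.1) (coord e.2.1) /
        (2 * latticeLength (flatMetric k c) e.2) := by
  have hg := posDef_flatMetric k hc
  rw [← sub_eq_zero]
  -- The variation given by the rule and the flat one agree off the body-diagonals, and both satisfy
  -- the linearized constraint. Their difference is then zero.
  refine eq_zero_of_fderiv_deficit_eq_zero (k := k) hc (fun e he => ?_) fun v => ?_
  · rw [Pi.sub_apply, h.fderiv_lengths_apply hc, sub_eq_zero]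
    by_cases h2 : e.2.1.card = 2
    · rw [faceVariation_of_card_eq_two hg w h2]
      have : (fun δ => lengths k c δ (b δ) e) = fun δ => flatLength k c e.2 + δ ⟨e, h2⟩ := by
        ext δ; simp [lengths, h2]
      rw [this]
      have hd : HasFDerivAt (fun δ : FaceDiag n → ℝ => flatLength k c e.2 + δ ⟨e, h2⟩)
          (ContinuousLinearMap.proj (R := ℝ) (φ := fun _ : FaceDiag n => ℝ) ⟨e, h2⟩) 0 :=
        (hasFDerivAt_apply _ _).const_add _
      rw [hd.fderiv]
      rfl
    · rw [faceVariation_of_card_eq_one _ w (card_eq_one_of_ne e.2 h2 he)]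
      have : (fun δ => lengths k c δ (b δ) e) = fun _ => flatLength k c e.2 := by
        ext δ; simp [lengths, h2, he]
      rw [this, fderiv_fun_const]
      rfl
  · rw [map_sub, h.fderiv_deficit_bodyDiag hc,
      fderiv_deficit_latticeLength hg (isHermitian_faceVariation _ _), sub_zero]

end linearization

/-! ### Functions that do not react to first order to changes of the directions -/

/-- A function of the face-diagonals that vanishes in the flat triangulation and does not change to
first order if the face-diagonals of each direction change at the same rate. -/
def IsStationary {n : Fin 3 → ℕ} [∀ i, NeZero (n i)] (f : (FaceDiag n → ℝ) → ℝ) : Prop :=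
  f 0 = 0 ∧ ∃ f' : (FaceDiag n → ℝ) →L[ℝ] ℝ, HasFDerivAt f f' 0 ∧
    ∀ w : Dir → ℝ, f' (fun j => w j.1.2) = 0

namespace IsStationary

variable {n : Fin 3 → ℕ} [∀ i, NeZero (n i)] {f g h : (FaceDiag n → ℝ) → ℝ}

theorem add (hf : IsStationary f) (hg : IsStationary g) : IsStationary fun δ => f δ + g δ := by
  obtain ⟨f0, f', hf, hf'⟩ := hf
  obtain ⟨g0, g', hg, hg'⟩ := hg
  exact ⟨by simp [f0, g0], f' + g', hf.add hg, fun w => by simp [hf', hg']⟩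

theorem neg (hf : IsStationary f) : IsStationary fun δ => -f δ := by
  obtain ⟨f0, f', hf, hf'⟩ := hf
  exact ⟨by simp [f0], -f', hf.neg, fun w => by simp [hf']⟩

theorem sub (hf : IsStationary f) (hg : IsStationary g) : IsStationary fun δ => f δ - g δ := by
  simpa only [sub_eq_add_neg] using hf.add hg.neg

theorem sum {ι : Type*} {s : Finset ι} {f : ι → (FaceDiag n → ℝ) → ℝ}
    (hf : ∀ i ∈ s, IsStationary (f i)) : IsStationary fun δ => ∑ i ∈ s, f i δ := by
  classical
  induction s using Finset.induction_on with
  | empty => exact ⟨by simp, 0, by simpa using hasFDerivAt_const (0 : ℝ) _, fun w => rfl⟩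
  | insert a s ha ih =>
    simp only [Finset.sum_insert ha]
    exact (hf a (Finset.mem_insert_self a s)).add
      (ih fun i hi => hf i (Finset.mem_insert_of_mem hi))

/-- Because `f 0 = 0`, the error splits as `h 0 * (f - f') + (h - h 0) * f`, and the second term is
`o(1) * O(δ)`. Mere continuity of `h` suffices. -/
theorem mul_left (hf : IsStationary f) (hh : ContinuousAt h 0) :
    IsStationary fun δ => h δ * f δ := by
  obtain ⟨f0, f', hf, hf'⟩ := hf
  refine ⟨by simp [f0], h 0 • f', ?_, fun w => by simp [hf']⟩
  refine HasFDerivAt.of_isLittleO ?_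
  have h1 : (fun δ => f δ - f' δ) =o[𝓝 0] fun δ : FaceDiag n → ℝ => δ := by
    simpa [f0] using hf.isLittleO
  have h2 : f =O[𝓝 0] fun δ : FaceDiag n → ℝ => δ := by
    simpa [f0] using hf.isBigO_sub
  have h3 : (fun δ => h δ - h 0) =o[𝓝 0] fun _ => (1 : ℝ) := by
    rw [isLittleO_one_iff]
    simpa using hh.tendsto.sub_const (h 0)
  have h4 : (fun δ => (h δ - h 0) * f δ) =o[𝓝 0] fun δ : FaceDiag n → ℝ => δ := by
    have := h3.mul_isBigO h2.norm_right
    simp only [one_mul] at this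
    exact isLittleO_norm_right.1 this
  refine ((h1.const_mul_left (h 0)).add h4).congr (fun δ => ?_) fun δ => by simp
  simp [f0]
  ring

theorem div (hf : IsStationary f) (hh : ContinuousAt h 0) (h0 : h 0 ≠ 0) :
    IsStationary fun δ => f δ / h δ := by
  have he : (fun δ => f δ / h δ) = fun δ => h⁻¹ δ * f δ :=
    funext fun δ => by rw [Pi.inv_apply, div_eq_inv_mul]
  exact he ▸ hf.mul_left (hh.inv₀ h0)

end IsStationary

/-! ### The linearized flow -/

section flow

variable {n : Fin 3 → ℕ} [∀ i, NeZero (n i)] {k : BlockType} {c : ℝ}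
  {b : (FaceDiag n → ℝ) → Vertex n → ℝ}

theorem IsLinearFlatBlockRule.isStationary_deficit (h : IsLinearFlatBlockRule k c b) (hc : 0 < c)
    (e : Edge n) : IsStationary fun δ => deficit (lengths k c δ (b δ)) e := by
  have hg := posDef_flatMetric k hc
  refine ⟨?_, _, h.hasFDerivAt_deficit hc e, fun w => ?_⟩
  · change deficit (lengths k c 0 (b 0)) e = 0
    rw [h.lengths_zero hc]
    exact deficit_latticeLength hg e
  · rw [ContinuousLinearMap.comp_apply, h.fderiv_lengths hc w]
    exact fderiv_deficit_latticeLength hg (isHermitian_faceVariation _ _) e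

theorem IsLinearFlatBlockRule.continuousAt_lengths (h : IsLinearFlatBlockRule k c b) (hc : 0 < c) :
    ContinuousAt (fun δ => lengths k c δ (b δ)) 0 :=
  (h.differentiableAt_lengths hc).continuousAt

theorem IsLinearFlatBlockRule.continuousAt_length (h : IsLinearFlatBlockRule k c b) (hc : 0 < c)
    (e : Edge n) : ContinuousAt (fun δ => lengths k c δ (b δ) e) 0 :=
  continuousAt_pi.1 (h.continuousAt_lengths hc) e

theorem IsLinearFlatBlockRule.isStationary_scalarCurv (h : IsLinearFlatBlockRule k c b)
    (hc : 0 < c) (v : Vertex n) : IsStationary fun δ => scalarCurv (lengths k c δ (b δ)) v := by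
  refine IsStationary.div (.sum fun S _ => .add
    ((h.isStationary_deficit hc _).mul_left (h.continuousAt_length hc _))
    ((h.isStationary_deficit hc _).mul_left (h.continuousAt_length hc _)))
    (continuousAt_vertexVolume (h.continuousAt_lengths hc) v) ?_
  rw [h.lengths_zero hc]
  exact (vertexVolume_pos (posDef_flatMetric k hc) v).ne'

theorem IsLinearFlatBlockRule.isStationary_curvTerm (h : IsLinearFlatBlockRule k c b)
    (hc : 0 < c) (e e' e'' : Edge n) :
    IsStationary fun δ => curvTerm (lengths k c δ (b δ)) e e' e'' := by
  have hL := h.continuousAt_length hc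
  have hpos : ∀ e, lengths k c 0 (b 0) e ≠ 0 := fun e => by
    rw [h.lengths_zero hc]
    exact (latticeLength_pos (posDef_flatMetric k hc) e.2).ne'
  refine (h.isStationary_deficit hc e').mul_left ((continuousAt_const.mul (hL e')).mul
    (ContinuousAt.pow (ContinuousAt.div ((((hL e).pow 2).add ((hL e').pow 2)).sub ((hL e'').pow 2))
      ((continuousAt_const.mul (hL e)).mul (hL e')) ?_) 2))
  simp [hpos]

theorem IsLinearFlatBlockRule.isStationary_sectionalCurv (h : IsLinearFlatBlockRule k c b)
    (hc : 0 < c) (e : Edge n) :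
    IsStationary fun δ => sectionalCurv (lengths k c δ (b δ)) e := by
  have hg := posDef_flatMetric k hc
  have ht := h.isStationary_curvTerm hc
  refine IsStationary.div (.add ((h.isStationary_deficit hc e).mul_left (h.continuousAt_length hc e))
    (.add (.add (.sum fun B _ => (ht _ _ _).add (ht _ _ _)) (.sum fun A _ => (ht _ _ _).add (ht _ _ _)))
      (.sum fun P _ => (ht _ _ _).add (ht _ _ _))))
    (continuousAt_edgeVolume (h.continuousAt_lengths hc) hg (h.lengths_zero hc) e) ?_
  rw [h.lengths_zero hc]
  exact (edgeVolume_pos hg e).ne'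

theorem IsLinearFlatBlockRule.isStationary_faceFlow (h : IsLinearFlatBlockRule k c b)
    (hc : 0 < c) (i : FaceDiag n) : IsStationary fun δ => faceFlow k c b δ i :=
  .neg (.mul_left (.sub
    (.mul_left (.add (h.isStationary_scalarCurv hc _) (h.isStationary_scalarCurv hc _))
      continuousAt_const) (h.isStationary_sectionalCurv hc _)) (h.continuousAt_length hc _))

end flow

end FlatBlocks

end

/-! ### The coefficient matrix and its kernel -/

theorem theorem7 (k : FlatBlocks.BlockType) (n : Fin 3 → ℕ) [∀ i, NeZero (n i)]
    (c : ℝ) (hc : 0 < c) :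
    (∃ b : (FlatBlocks.FaceDiag n → ℝ) → FlatBlocks.Vertex n → ℝ,
      FlatBlocks.IsFlatBlockRule k c b) ∧
    ∀ b : (FlatBlocks.FaceDiag n → ℝ) → FlatBlocks.Vertex n → ℝ,
      FlatBlocks.IsLinearFlatBlockRule k c b →
      ∃ A : Matrix (FlatBlocks.FaceDiag n) (FlatBlocks.FaceDiag n) ℝ,
        FlatBlocks.IsCoefficientMatrix (FlatBlocks.faceFlow k c b) A ∧
        (∀ i, ∑ j, A i j = 0) ∧
        Module.End.HasEigenvector (Matrix.toLin' A) 0 (fun _ => (1 : ℝ)) ∧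
        (∀ w : FlatBlocks.Dir → ℝ, A *ᵥ (fun j => w j.1.2) = 0) := by
  refine ⟨FlatBlocks.exists_isFlatBlockRule k hc, fun b h => ?_⟩
  choose h0 f' hf' hw using h.isStationary_faceFlow hc
  have hA : ∀ x, LinearMap.toMatrix' (ContinuousLinearMap.pi f').toLinearMap *ᵥ x =
      fun i => f' i x := fun x => by
    rw [← Matrix.toLin'_apply, Matrix.toLin'_toMatrix']
    rfl
  have hker : ∀ w : FlatBlocks.Dir → ℝ,
      LinearMap.toMatrix' (ContinuousLinearMap.pi f').toLinearMap *ᵥ (fun j => w j.1.2) = 0 :=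
    fun w => by
      rw [hA]
      exact funext fun i => hw i w
  refine ⟨LinearMap.toMatrix' (ContinuousLinearMap.pi f').toLinearMap, ⟨funext h0, ?_⟩,
    fun i => ?_, ⟨?_, ?_⟩, hker⟩
  · rw [Matrix.toLin'_toMatrix']
    exact hasFDerivAt_pi.2 hf'
  -- The row sums are the entries of `A *ᵥ 1`, the case `w = 1`.
  · simpa [Matrix.mulVec, dotProduct] using congrFun (hker fun _ => 1) i
  · rw [Module.End.mem_eigenspace_iff, zero_smul, Matrix.toLin'_apply]
    exact hker fun _ => 1
  · intro h1
    -- An eigenvector must be non-zero, for which some face-diagonal has to exist: here the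
    -- `xy`-diagonal at the vertex `0`.
    exact one_ne_zero (congrFun h1 ⟨(0, FlatBlocks.faceDir 0 1), rfl⟩)
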